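/- Let $(M,\omega)$ be a Kähler manifold of complex dimension $n$, let $\pi:E\to M$ be a holomorphic vector bundle of rank $r$, and let $G$ be a smooth Hermitian metric on $E$. Let $z=(z^1,\dots,z^n)$ be local holomorphic coordinates on an open set $U\subset M$ and $e_1,\dots,e_r$ a holomorphic frame of $E$ over $U$. Write $\omega=\sqrt{-1}\,g_{\alpha\bar\beta}\,dz^\alpha\wedge d\bar z^\beta$, $G_{i\bar j}=\langle e_i,e_j\rangle$, and let $(G^{\bar j k})$ be the inverse matrix, $G_{i\bar j}G^{\bar jk}=\delta_i^k$ (summation convention). The coefficients of the Chern curvature of $(E,G)$ are $$R_{i\bar j\alpha\bar\beta}=-\partial_\alpha\partial_{\bar\beta}G_{i\bar j}+G^{\bar l k}\,\partial_\alpha G_{i\bar l}\,\partial_{\bar\beta}G_{k\bar j}.$$ Assume that $(E,G)$ is Griffiths negative, i.e. $R_{i\bar j\alpha\bar\beta}v^i\bar v^j\xi^\alpha\bar\xi^\beta<0$ for all nonzero $v=v^ie_i\in E$ and nonzero $\xi=\xi^\alpha\partial/\partial z^\alpha\in TM$ over the same point, in all such coordinates and frames. On $\pi^{-1}(U)$ use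 the holomorphic coordinates $(z,v)\mapsto v^ie_i(z)$, denoted collectively by $(x^A)$. Regard $G(z,v)=G_{i\bar j}(z)v^i\bar v^j$ as a function on the total space, and put $$\Omega=\pi^*\omega+\sqrt{-1}\,\partial\bar\partial G,\qquad \Omega_{\alpha\bar\beta}=g_{\alpha\bar\beta}-R_{i\bar j\alpha\bar\beta}v^i\bar v^j,\qquad \Omega_{\alpha\bar\beta}\Omega^{\bar\beta\gamma}=\delta_\alpha^\gamma,$$ $$\frac{\delta}{\delta z^\alpha}=\frac{\partial}{\partial z^\alpha}-\frac{\partial^2G}{\partial z^\alpha\partial\bar v^l}\,G^{\bar li}\frac{\partial}{\partial v^i},\qquad P=v^i\frac{\partial}{\partial v^i}.$$ Let $\langle\cdot,\cdot\rangle$ be the Hermitian product on the holomorphic tangent bundle $TE$ of the total space given by the coefficients of $\Omega$, $\nabla=\nabla'+\bar\partial$ its Chern connection, and $R^\Omega=\nabla'\circ\bar\partial+\bar\partial\circ\nabla'$ its Chern curvature, a $(1,1)$-form with values in $\mathrm{End}(TE)$. Then $\Omega$ is a Kähler metric on the total space, and at every point $(z,v)$ the following hold. (i) For all $i,j$, $$\Big\langle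 R^\Omega\Big(\frac{\partial}{\partial v^i}\Big),\frac{\partial}{\partial v^j}\Big\rangle=\big(R_{i\bar l\alpha\bar\beta}R_{k\bar j\gamma\bar\sigma}v^k\bar v^l\,\Omega^{\bar\beta\gamma}+R_{i\bar j\alpha\bar\sigma}\big)\,dz^\alpha\wedge d\bar z^\sigma .$$ (ii) For all $\alpha,\beta$, $$\Big\langle R^\Omega\Big(\frac{\delta}{\delta z^\alpha}\Big),\frac{\delta}{\delta z^\beta}\Big\rangle=\bar\partial\big(\partial\Omega_{\alpha\bar\sigma}\,\Omega^{\bar\sigma\gamma}\big)\Omega_{\gamma\bar\beta}-R_{p\bar l\gamma\bar\beta}R_{k\bar q\alpha\bar\sigma}v^k\bar v^l\,G^{\bar qp}\,dz^\gamma\wedge d\bar z^\sigma ,$$ where $\partial,\bar\partial$ are taken on the total space, in all the variables $(z,v)$. (iii) $\langle R^\Omega(X,\bar Y)\frac{\partial}{\partial v^i},\frac{\partial}{\partial v^j}\rangle=0$ for all $i,j$ and all $(1,0)$-vectors $X,Y$ at least one of which is vertical (a combination of the $\partial/\partial v^k$). (iv) $\langle\sqrt{-1}R^\Omega(P),P\rangle$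 is a non-positive real $(1,1)$-form: $\langle R^\Omega(X,\bar X)P,P\rangle$ is real and $\le 0$ for every $(1,0)$-vector $X$. (v) If $v\neq0$, then $\langle R^\Omega(\xi,\bar\xi)P,P\rangle<0$ for every nonzero horizontal vector $\xi=\xi^\alpha\,\delta/\delta z^\alpha$ at $(z,v)$. -/

import Mathlib

open scoped Manifold ContDiff ComplexConjugate ComplexOrder

noncomputable section

namespace TotalSpaceCurvature

/-! ### Local complex differential calculus on `κ → ℂ` -/

section Local

variable {κ ι : Type} [Fintype κ] [DecidableEq κ] [Fintype ι] [DecidableEq ι]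

/-- The Wirtinger derivative `∂f/∂x^A`. -/
def dz (A : κ) (f : (κ → ℂ) → ℂ) (x : κ → ℂ) : ℂ :=
  (1 / 2 : ℂ) *
    (fderiv ℝ f x (Pi.single A 1) - Complex.I * fderiv ℝ f x (Pi.single A Complex.I))

/-- The conjugate Wirtinger derivative `∂f/∂x̄^A`. -/
def dzbar (A : κ) (f : (κ → ℂ) → ℂ) (x : κ → ℂ) : ℂ :=
  (1 / 2 : ℂ) *
    (fderiv ℝ f x (Pi.single A 1) + Complex.I * fderiv ℝ f x (Pi.single A Complex.I))

/-- The Hermitian product `⟨u, w⟩ = H_{ij̄} u^i w̄^j` (linear in `u`, conjugate linear in `w`). -/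
def herm (H : Matrix ι ι ℂ) (u w : ι → ℂ) : ℂ := ∑ i, ∑ j, H i j * u i * conj (w j)

/-- `H = (H_{AB̄})` are the coefficients, on the set `U`, of a smooth Kähler metric
`i H_{AB̄} dx^A ∧ dx̄^B`: smooth, positive definite Hermitian, and `d`-closed. -/
structure IsKahlerOn (H : (κ → ℂ) → Matrix κ κ ℂ) (U : Set (κ → ℂ)) : Prop where
  smooth : ∀ A B, ContDiffOn ℝ ∞ (fun x => H x A B) U
  posDef : ∀ x ∈ U, (H x).PosDef
  closed : ∀ x ∈ U, ∀ A B C, dz C (fun y => H y A B) x = dz A (fun y => H y C B) x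

/-- `∇'_A s` for the Chern connection `∇ = ∇' + ∂̄` of the Hermitian metric `H_{ij̄} = ⟨e_i, e_j⟩`
in a holomorphic frame `e`: its connection matrix is `∂H · H⁻¹`. A section is given by its
components in the frame. -/
def chernNabla (H : (κ → ℂ) → Matrix ι ι ℂ) (A : κ) (s : (κ → ℂ) → ι → ℂ) :
    (κ → ℂ) → ι → ℂ :=
  fun x k => dz A (fun y => s y k) x
    + ∑ i, s x i * ∑ j, dz A (fun y => H y i j) x * (H x)⁻¹ j k

/-- `∂̄_B s`, in a holomorphic frame. -/
def dbarSection (B : κ) (s : (κ → ℂ) → ι → ℂ) : (κ → ℂ) → ι → ℂ :=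
  fun x k => dzbar B (fun y => s y k) x

/-- The Chern curvature `R = ∇' ∘ ∂̄ + ∂̄ ∘ ∇'`, a `(1,1)`-form with values in endomorphisms,
applied to a section `s` and evaluated on the tangent vectors `X = X^A ∂/∂x^A` and
`Ȳ = Ȳ^B ∂/∂x̄^B`; the coefficient of `dx^A ∧ dx̄^B` in `R s` is `∇'_A ∂̄_B s - ∂̄_B ∇'_A s`. -/
def chernCurvature (H : (κ → ℂ) → Matrix ι ι ℂ) (X Y : κ → ℂ) (s : (κ → ℂ) → ι → ℂ) :
    (κ → ℂ) → ι → ℂ :=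
  fun x k => ∑ A, ∑ B, X A * conj (Y B) *
    (chernNabla H A (dbarSection B s) x k - dbarSection B (chernNabla H A s) x k)

/-- The curvature coefficients
`R_{ij̄αβ̄} = -∂_α ∂_β̄ H_{ij̄} + H^{l̄k} ∂_α H_{il̄} ∂_β̄ H_{kj̄}`. -/
def curvCoeff (H : (κ → ℂ) → Matrix ι ι ℂ) (i j : ι) (α β : κ) (z : κ → ℂ) : ℂ :=
  -dz α (dzbar β (fun y => H y i j)) z
    + ∑ k, ∑ l, (H z)⁻¹ l k * dz α (fun y => H y i l) z * dzbar β (fun y => H y k j) z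

end Local

/-! ### Kähler metrics and Hermitian holomorphic bundles -/

section Global

/-- A Kähler metric on the complex manifold `M`: a field of sesquilinear forms on the
(holomorphic) tangent spaces whose coefficients
`g_{αβ̄} = g(∂/∂z^α, ∂/∂z^β)` in every holomorphic chart are those of a smooth Kähler metric. -/
structure KahlerMetric (n : ℕ) (M : Type*) [TopologicalSpace M] [ChartedSpace (Fin n → ℂ) M] where
  form : ∀ x : M, TangentSpace 𝓘(ℂ, Fin n → ℂ) x →ₗ[ℂ] TangentSpace 𝓘(ℂ, Fin n → ℂ) x →ₗ⋆[ℂ] ℂ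
  isKahlerOn : ∀ φ ∈ IsManifold.maximalAtlas 𝓘(ℂ, Fin n → ℂ) ω M,
    IsKahlerOn
      (fun z => Matrix.of fun α β => form (φ.symm z)
        (mfderiv 𝓘(ℂ, Fin n → ℂ) 𝓘(ℂ, Fin n → ℂ) φ.symm z (Pi.single α 1 : Fin n → ℂ))
        (mfderiv 𝓘(ℂ, Fin n → ℂ) 𝓘(ℂ, Fin n → ℂ) φ.symm z (Pi.single β 1 : Fin n → ℂ)))
      φ.target

variable {n r : ℕ} {M : Type*} [TopologicalSpace M] [ChartedSpace (Fin n → ℂ) M]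

/-- The coefficients `g_{αβ̄}` of a Kähler metric in the chart `φ`. -/
def KahlerMetric.coeff (g : KahlerMetric n M) (φ : OpenPartialHomeomorph M (Fin n → ℂ))
    (z : Fin n → ℂ) : Matrix (Fin n) (Fin n) ℂ :=
  Matrix.of fun α β => g.form (φ.symm z)
    (mfderiv 𝓘(ℂ, Fin n → ℂ) 𝓘(ℂ, Fin n → ℂ) φ.symm z (Pi.single α 1 : Fin n → ℂ))
    (mfderiv 𝓘(ℂ, Fin n → ℂ) 𝓘(ℂ, Fin n → ℂ) φ.symm z (Pi.single β 1 : Fin n → ℂ))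

variable (n r) (E : M → Type*) [∀ x, AddCommGroup (E x)] [∀ x, Module ℂ (E x)]
  [TopologicalSpace (Bundle.TotalSpace (Fin r → ℂ) E)] [∀ x, TopologicalSpace (E x)]
  [FiberBundle (Fin r → ℂ) E]

/-- A holomorphic coordinate system `z = (z^1, …, z^n)` of `M` together with a holomorphic frame
`e_1, …, e_r` of `E` over its domain. -/
structure LocalCoords where
  chart : OpenPartialHomeomorph M (Fin n → ℂ)
  chart_mem : chart ∈ IsManifold.maximalAtlas 𝓘(ℂ, Fin n → ℂ) ω M
  frame : Fin r → (x : M) → E x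
  isLocalFrame : IsLocalFrameOn 𝓘(ℂ, Fin n → ℂ) (Fin r → ℂ) ω frame chart.source

/-- A smooth Hermitian metric on the holomorphic vector bundle `E`. -/
structure HermitianMetric where
  form : ∀ x : M, E x →ₗ[ℂ] E x →ₗ⋆[ℂ] ℂ
  conj_symm : ∀ x v w, form x w v = conj (form x v w)
  pos : ∀ x v, v ≠ 0 → 0 < (form x v v).re
  smooth : ∀ (c : LocalCoords n r E) (i j : Fin r), ContDiffOn ℝ ∞
    (fun z => form (c.chart.symm z) (c.frame i (c.chart.symm z)) (c.frame j (c.chart.symm z)))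
    c.chart.target

variable {n r E}

/-- Every point of `M` lies in the domain of such a coordinate system. -/
theorem exists_localCoords [IsManifold 𝓘(ℂ, Fin n → ℂ) ω M] [VectorBundle ℂ (Fin r → ℂ) E]
    [ContMDiffVectorBundle ω (Fin r → ℂ) E 𝓘(ℂ, Fin n → ℂ)] (p : M) :
    ∃ c : LocalCoords n r E, p ∈ c.chart.source := by
  let e := trivializationAt (Fin r → ℂ) E p
  have hp : p ∈ e.baseSet := FiberBundle.mem_baseSet_trivializationAt' p
  have hf := e.isLocalFrameOn_localFrame_baseSet 𝓘(ℂ, Fin n → ℂ) ω (Pi.basisFun ℂ (Fin r))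
  refine ⟨⟨(chartAt (Fin n → ℂ) p).restr e.baseSet,
    restr_mem_maximalAtlas _
      (StructureGroupoid.chart_mem_maximalAtlas _ p) e.open_baseSet,
    e.localFrame (Pi.basisFun ℂ (Fin r)), hf.mono ?_⟩, ?_⟩
  · intro x hx
    simp only [OpenPartialHomeomorph.restr_source, e.open_baseSet.interior_eq] at hx
    exact hx.2
  · simp only [OpenPartialHomeomorph.restr_source, e.open_baseSet.interior_eq]
    exact ⟨mem_chart_source _ p, hp⟩

namespace HermitianMetric

variable (G : HermitianMetric n r E) (c : LocalCoords n r E)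

/-- The matrix `G_{ij̄}(z) = ⟨e_i, e_j⟩`. -/
def coeff (z : Fin n → ℂ) : Matrix (Fin r) (Fin r) ℂ :=
  Matrix.of fun i j =>
    G.form (c.chart.symm z) (c.frame i (c.chart.symm z)) (c.frame j (c.chart.symm z))

/-- The curvature coefficients `R_{ij̄αβ̄}(z)` of `(E, G)`. -/
def R (i j : Fin r) (α β : Fin n) (z : Fin n → ℂ) : ℂ := curvCoeff (G.coeff c) i j α β z

/-- Griffiths negativity: `R_{ij̄αβ̄} v^i v̄^j ξ^α ξ̄^β < 0` for nonzero `v` and `ξ`. -/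
def GriffithsNegative : Prop :=
  ∀ c : LocalCoords n r E, ∀ z ∈ c.chart.target, ∀ v : Fin r → ℂ, v ≠ 0 →
    ∀ ξ : Fin n → ℂ, ξ ≠ 0 →
    (∑ i, ∑ j, ∑ α, ∑ β,
      G.R c i j α β z * v i * conj (v j) * ξ α * conj (ξ β)).re < 0

/-- The function `G(v) = ⟨v, v⟩` on the total space. -/
def potential (p : Bundle.TotalSpace (Fin r → ℂ) E) : ℂ := G.form p.proj p.snd p.snd

end HermitianMetric

/-! ### The metric `Ω = π^*ω + i∂∂̄G` in the holomorphic coordinates `(z, v)` of the total space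

A point of the coordinate space is `x : Fin n ⊕ Fin r → ℂ`, with `z^α = x (inl α)` and
`v^i = x (inr i)`; tangent vectors and vector fields are given by their components in the
holomorphic frame `∂/∂z^α`, `∂/∂v^i`. -/

/-- The coordinates `z`. -/
def zPart (x : Fin n ⊕ Fin r → ℂ) : Fin n → ℂ := fun α => x (Sum.inl α)

/-- The coordinates `v`. -/
def vPart (x : Fin n ⊕ Fin r → ℂ) : Fin r → ℂ := fun i => x (Sum.inr i)

namespace LocalCoords

variable (c : LocalCoords n r E)

/-- The range of the coordinates `(z, v)`. -/
def domain : Set (Fin n ⊕ Fin r → ℂ) := {x | zPart x ∈ c.chart.target}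

/-- The point `v = v^i e_i(z)` of the total space with coordinates `(z, v)`. -/
def point (x : Fin n ⊕ Fin r → ℂ) : Bundle.TotalSpace (Fin r → ℂ) E :=
  ⟨c.chart.symm (zPart x), ∑ i, vPart x i • c.frame i (c.chart.symm (zPart x))⟩

end LocalCoords

variable (g : KahlerMetric n M) (G : HermitianMetric n r E) (c : LocalCoords n r E)

/-- The coefficients `∂²G/∂x^A∂x̄^B` of `∂∂̄G` in the coordinates `x = (z, v)`. -/
def leviG (x : Fin n ⊕ Fin r → ℂ) : Matrix (Fin n ⊕ Fin r) (Fin n ⊕ Fin r) ℂ :=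
  Matrix.of fun A B => dz A (dzbar B (fun y => G.potential (c.point y))) x

/-- The coefficients of `Ω = π^*ω + i∂∂̄G`, `ω = i g_{αβ̄} dz^α ∧ dz̄^β`, in the coordinates
`x = (z, v)`: `Ω = i (Omega)_{AB̄} dx^A ∧ dx̄^B`. -/
def Omega (x : Fin n ⊕ Fin r → ℂ) : Matrix (Fin n ⊕ Fin r) (Fin n ⊕ Fin r) ℂ :=
  Matrix.fromBlocks (g.coeff c.chart (zPart x)) 0 0 0 + leviG G c x

/-- `Ω_{αβ̄} = -R_{ij̄αβ̄} v^i v̄^j + g_{αβ̄}`. -/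
def OmegaH (x : Fin n ⊕ Fin r → ℂ) : Matrix (Fin n) (Fin n) ℂ :=
  Matrix.of fun α β =>
    -(∑ i, ∑ j, G.R c i j α β (zPart x) * vPart x i * conj (vPart x j))
      + g.coeff c.chart (zPart x) α β

/-- The vertical vector field `∂/∂v^i`. -/
def vert (i : Fin r) : (Fin n ⊕ Fin r → ℂ) → (Fin n ⊕ Fin r → ℂ) :=
  fun _ => Pi.single (Sum.inr i) 1

/-- The horizontal vector field `δ/δz^α = ∂/∂z^α - G_{αl̄} G^{l̄i} ∂/∂v^i`. -/
def hor (α : Fin n) : (Fin n ⊕ Fin r → ℂ) → (Fin n ⊕ Fin r → ℂ) :=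
  fun x => Pi.single (Sum.inl α) 1 -
    ∑ i, (∑ l, leviG G c x (Sum.inl α) (Sum.inr l) * (G.coeff c (zPart x))⁻¹ l i) •
      (Pi.single (Sum.inr i) 1 : Fin n ⊕ Fin r → ℂ)

/-- The tautological section `P = v^i ∂/∂v^i`. -/
def taut : (Fin n ⊕ Fin r → ℂ) → (Fin n ⊕ Fin r → ℂ) :=
  fun x => ∑ i, vPart x i • (Pi.single (Sum.inr i) 1 : Fin n ⊕ Fin r → ℂ)

/-- `⟨R^Ω(X, Ȳ) s, t⟩` at the point with coordinates `x`: the Chern curvature of the holomorphic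
tangent bundle of the total space with the metric `Ω`, applied to the vector fields `s`, `t`. -/
def curvOmega (X Y : Fin n ⊕ Fin r → ℂ)
    (s t : (Fin n ⊕ Fin r → ℂ) → (Fin n ⊕ Fin r → ℂ)) (x : Fin n ⊕ Fin r → ℂ) : ℂ :=
  herm (Omega g G c x) (chernCurvature (Omega g G c) X Y s x) (t x)

end Global

end TotalSpaceCurvature

end

open TotalSpaceCurvature

/-! In the coordinates `(z, v)` the metric Ω is a block matrix whose vertical block is `h =
G_{ij̄}`, constant along the fibres. The Schur complement of that block is exactly `Ω_{αβ̄} = g - R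
v v̄`: the term `∂h h⁻¹ ∂̄h` of the curvature is the Schur correction (`horMetric_eq_schur`). Put `M
= -R v v̄`. Griffiths negativity gives `M ≥ 0`, so the Schur complement `M + g`, and with it Ω, is
positive definite. Ω is closed because ω is closed and the rest is `i∂∂̄` of a function.

Geometrically, the vertical bundle `V` is a holomorphic subbundle of `TE` with metric `π^*G`, and
the quotient `TE/V` carries the Schur complement as metric, `δ/δz^α` being the orthogonal lift of
`∂/∂z^α`. The curvature of Ω restricted to either piece is the curvature of that piece corrected by
the second fundamental form (`mul_curvMatrix_mul_of_sub`, `mul_curvMatrix_mul_of_quotient`).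
Differentiating the mixed block covariantly shows that this form is the curvature of `G` contracted
with `v` or `v̄`; it has no component along the fibres because the mixed block is holomorphic in `v`
(its adjoint antiholomorphic). This gives (i), (ii) and (iii).

Contracting (i) with `P` gives `-(M - M (M + g)⁻¹ M)`. The bracket is a sum of congruences of `M`
and of `g` (`sub_mul_inv_mul_eq`), hence positive semidefinite, and positive definite when `M` is,
that is, off the zero section. This gives (iv) and (v).

All computations are carried out with matrices of functions in one coordinate system; identities to
be differentiated are kept as identities near the point. -/

noncomputable section

set_option linter.unusedSectionVars false

namespace TotalSpaceCurvature

/-! ### Calculus of Wirtinger derivatives -/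

section Calculus

variable {κ : Type} [Fintype κ] [DecidableEq κ]

/-- The first order operators `½ (∂/∂a^A + ε i ∂/∂b^A)`, `x^A = a^A + i b^A`: the Wirtinger
derivative for `ε = -1`, its conjugate for `ε = 1`. -/
def wirtinger (ε : ℂ) (A : κ) (f : (κ → ℂ) → ℂ) (x : κ → ℂ) : ℂ :=
  (1 / 2 : ℂ) *
    (fderiv ℝ f x (Pi.single A 1) + ε * Complex.I * fderiv ℝ f x (Pi.single A Complex.I))

theorem dz_eq_wirtinger (A : κ) : dz A = wirtinger (-1) A := by
  funext f x
  simp only [dz, wirtinger]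
  ring

theorem dzbar_eq_wirtinger (A : κ) : dzbar A = wirtinger 1 A := by
  funext f x
  simp only [dzbar, wirtinger]
  ring

theorem wirtinger_congr {ε : ℂ} {A : κ} {f f' : (κ → ℂ) → ℂ} {x : κ → ℂ} (h : f =ᶠ[nhds x] f') :
    wirtinger ε A f x = wirtinger ε A f' x := by
  simp only [wirtinger, h.fderiv_eq]

@[simp]
theorem wirtinger_const (ε : ℂ) (A : κ) (a : ℂ) (x : κ → ℂ) :
    wirtinger ε A (fun _ => a) x = 0 := by
  simp [wirtinger]

theorem wirtinger_add {ε : ℂ} {A : κ} {f f' : (κ → ℂ) → ℂ} {x : κ → ℂ}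
    (hf : DifferentiableAt ℝ f x) (hf' : DifferentiableAt ℝ f' x) :
    wirtinger ε A (fun y => f y + f' y) x = wirtinger ε A f x + wirtinger ε A f' x := by
  simp only [wirtinger, fderiv_fun_add hf hf', _root_.add_apply]
  ring

theorem wirtinger_neg {ε : ℂ} {A : κ} {f : (κ → ℂ) → ℂ} {x : κ → ℂ} :
    wirtinger ε A (fun y => - f y) x = - wirtinger ε A f x := by
  simp only [wirtinger, fderiv_fun_neg, _root_.neg_apply]
  ring

theorem wirtinger_sum {ι : Type*} {s : Finset ι} {ε : ℂ} {A : κ} {f : ι → (κ → ℂ) → ℂ} {x : κ → ℂ}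
    (hf : ∀ i ∈ s, DifferentiableAt ℝ (f i) x) :
    wirtinger ε A (fun y => ∑ i ∈ s, f i y) x = ∑ i ∈ s, wirtinger ε A (f i) x := by
  simp only [wirtinger, fderiv_fun_sum hf, _root_.sum_apply, Finset.mul_sum,
    ← Finset.sum_add_distrib]

theorem wirtinger_mul {ε : ℂ} {A : κ} {f f' : (κ → ℂ) → ℂ} {x : κ → ℂ}
    (hf : DifferentiableAt ℝ f x) (hf' : DifferentiableAt ℝ f' x) :
    wirtinger ε A (fun y => f y * f' y) x
      = wirtinger ε A f x * f' x + f x * wirtinger ε A f' x := by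
  simp only [wirtinger, fderiv_fun_mul hf hf', _root_.add_apply,
    _root_.smul_apply, smul_eq_mul]
  ring

theorem contDiffAt_wirtinger {ε : ℂ} {A : κ} {f : (κ → ℂ) → ℂ} {x : κ → ℂ}
    (hf : ContDiffAt ℝ ∞ f x) : ContDiffAt ℝ ∞ (wirtinger ε A f) x := by
  have h : ContDiffAt ℝ ∞ (fderiv ℝ f) x := hf.fderiv_right (by simp)
  unfold wirtinger
  fun_prop

theorem wirtinger_comm {ε ε' : ℂ} {A B : κ} {f : (κ → ℂ) → ℂ} {x : κ → ℂ}
    (hf : ContDiffAt ℝ ∞ f x) :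
    wirtinger ε A (wirtinger ε' B f) x = wirtinger ε' B (wirtinger ε A f) x := by
  have h : DifferentiableAt ℝ (fderiv ℝ f) x :=
    (hf.fderiv_right (m := ∞) (by simp)).differentiableAt (by simp)
  have hs : IsSymmSndFDerivAt ℝ f x := hf.isSymmSndFDerivAt (by
    rw [minSmoothness_of_isRCLikeNormedField]
    exact WithTop.coe_le_coe.2 le_top)
  -- Both sides become combinations of the second real derivative at the vectors 1 and i in the
  -- directions A and B; its symmetry matches them term by term.
  have key : ∀ (δ : ℂ) (C : κ) (w : κ → ℂ), fderiv ℝ (wirtinger δ C f) x w =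
      (1 / 2 : ℂ) * (fderiv ℝ (fderiv ℝ f) x w (Pi.single C 1)
        + δ * Complex.I * fderiv ℝ (fderiv ℝ f) x w (Pi.single C Complex.I)) := by
    intro δ C w
    have h1 : ∀ u, DifferentiableAt ℝ (fun y => fderiv ℝ f y u) x := fun u => by fun_prop
    have h2 : ∀ u, fderiv ℝ (fun y => fderiv ℝ f y u) x w = fderiv ℝ (fderiv ℝ f) x w u := by
      intro u
      rw [fderiv_clm_apply h (by fun_prop)]
      simp
    unfold wirtinger
    rw [fderiv_const_mul ((h1 _).fun_add ((h1 _).const_mul _)), _root_.smul_apply,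
      fderiv_fun_add (h1 _) ((h1 _).const_mul _), _root_.add_apply,
      fderiv_const_mul (h1 _), _root_.smul_apply, h2, h2]
    simp
  simp only [wirtinger.eq_1 ε A (wirtinger ε' B f), wirtinger.eq_1 ε' B (wirtinger ε A f), key]
  rw [hs.eq (Pi.single A 1) (Pi.single B 1), hs.eq (Pi.single A 1) (Pi.single B Complex.I),
    hs.eq (Pi.single A Complex.I) (Pi.single B 1),
    hs.eq (Pi.single A Complex.I) (Pi.single B Complex.I)]
  ring

/-- Conjugation turns the coefficient εi into -ε̄i; for ε = ±1 it exchanges ∂ and ∂̄. -/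
theorem wirtinger_conj {ε : ℂ} {A : κ} {f : (κ → ℂ) → ℂ} {x : κ → ℂ} :
    wirtinger ε A (fun y => conj (f y)) x = conj (wirtinger (- conj ε) A f x) := by
  have h : fderiv ℝ (fun y => conj (f y)) x
      = (Complex.conjCLE : ℂ →L[ℝ] ℂ).comp (fderiv ℝ f x) := by
    have := Complex.conjCLE.comp_fderiv (f := f) (x := x)
    exact this
  have h2 : conj (2 : ℂ) = 2 := Complex.conj_ofNat 2
  simp [wirtinger, h, h2]

theorem wirtinger_coord (ε : ℂ) (A B : κ) (x : κ → ℂ) :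
    wirtinger ε A (fun y => y B) x = if A = B then (1 - ε) / 2 else 0 := by
  have h : fderiv ℝ (fun y : κ → ℂ => y B) x
      = (ContinuousLinearMap.proj B : (κ → ℂ) →L[ℝ] ℂ) :=
    (ContinuousLinearMap.proj B : (κ → ℂ) →L[ℝ] ℂ).fderiv
  simp only [wirtinger, h, ContinuousLinearMap.proj_apply]
  split_ifs with hAB
  · subst hAB
    simp only [Pi.single_eq_same, mul_assoc, Complex.I_mul_I]
    ring
  · simp [Pi.single_eq_of_ne (Ne.symm hAB)]

theorem wirtinger_conj_coord (ε : ℂ) (A B : κ) (x : κ → ℂ) :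
    wirtinger ε A (fun y => conj (y B)) x = if A = B then (1 + ε) / 2 else 0 := by
  rw [wirtinger_conj, wirtinger_coord]
  have h2 : conj (2 : ℂ) = 2 := Complex.conj_ofNat 2
  split_ifs <;> simp [h2]

end Calculus

/-! ### Matrix valued functions -/

section MatrixCalculus

variable {κ : Type} [Fintype κ] [DecidableEq κ] {ι ι' ι'' : Type*}

/-- A matrix valued function with smooth entries at `x`. -/
def SmoothAt (F : (κ → ℂ) → Matrix ι ι' ℂ) (x : κ → ℂ) : Prop :=
  ∀ i j, ContDiffAt ℝ ∞ (fun y => F y i j) x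

/-- The entrywise Wirtinger derivative of a matrix valued function. -/
def matWirtinger (ε : ℂ) (A : κ) (F : (κ → ℂ) → Matrix ι ι' ℂ) (x : κ → ℂ) : Matrix ι ι' ℂ :=
  Matrix.of fun i j => wirtinger ε A (fun y => F y i j) x

@[simp]
theorem matWirtinger_apply (ε : ℂ) (A : κ) (F : (κ → ℂ) → Matrix ι ι' ℂ) (x : κ → ℂ)
    (i : ι) (j : ι') : matWirtinger ε A F x i j = wirtinger ε A (fun y => F y i j) x := rfl

theorem SmoothAt.differentiableAt {F : (κ → ℂ) → Matrix ι ι' ℂ} {x : κ → ℂ} (hF : SmoothAt F x)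
    (i : ι) (j : ι') : DifferentiableAt ℝ (fun y => F y i j) x :=
  (hF i j).differentiableAt (by simp)

theorem smoothAt_const (C : Matrix ι ι' ℂ) (x : κ → ℂ) : SmoothAt (fun _ => C) x :=
  fun _ _ => contDiffAt_const

theorem SmoothAt.matWirtinger {ε : ℂ} {A : κ} {F : (κ → ℂ) → Matrix ι ι' ℂ} {x : κ → ℂ}
    (hF : SmoothAt F x) : SmoothAt (matWirtinger ε A F) x :=
  fun i j => contDiffAt_wirtinger (hF i j)

theorem SmoothAt.neg {F : (κ → ℂ) → Matrix ι ι' ℂ} {x : κ → ℂ}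
    (hF : SmoothAt F x) : SmoothAt (fun y => - F y) x :=
  fun i j => (hF i j).neg

theorem SmoothAt.add {F F' : (κ → ℂ) → Matrix ι ι' ℂ} {x : κ → ℂ}
    (hF : SmoothAt F x) (hF' : SmoothAt F' x) : SmoothAt (fun y => F y + F' y) x :=
  fun i j => (hF i j).add (hF' i j)

theorem SmoothAt.mul [Fintype ι'] {F : (κ → ℂ) → Matrix ι ι' ℂ} {K : (κ → ℂ) → Matrix ι' ι'' ℂ}
    {x : κ → ℂ} (hF : SmoothAt F x) (hK : SmoothAt K x) : SmoothAt (fun y => F y * K y) x := by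
  intro i j
  simp only [Matrix.mul_apply]
  exact ContDiffAt.sum fun k _ => (hF i k).mul (hK k j)

theorem contDiffAt_det [Fintype ι] [DecidableEq ι] {F : (κ → ℂ) → Matrix ι ι ℂ} {x : κ → ℂ}
    (hF : SmoothAt F x) : ContDiffAt ℝ ∞ (fun y => (F y).det) x := by
  simp only [Matrix.det_apply]
  exact ContDiffAt.sum fun σ _ => (contDiffAt_prod fun i _ => hF _ _).const_smul _

/-- Cramer's rule: each entry of the inverse is a determinant divided by a nonvanishing determinant,
the numerator having one row replaced by a constant one. -/
theorem SmoothAt.inv [Fintype ι] [DecidableEq ι] {F : (κ → ℂ) → Matrix ι ι ℂ} {x : κ → ℂ}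
    (hF : SmoothAt F x) (hx : IsUnit (F x)) : SmoothAt (fun y => (F y)⁻¹) x := by
  intro i j
  simp only [Matrix.inv_def, Matrix.smul_apply, Matrix.adjugate_apply, Ring.inverse_eq_inv',
    smul_eq_mul]
  refine ((contDiffAt_det hF).inv ?_).mul (contDiffAt_det fun k l => ?_)
  · exact ((Matrix.isUnit_iff_isUnit_det _).mp hx).ne_zero
  · simp only [Matrix.updateRow_apply]
    split_ifs
    · exact contDiffAt_const
    · exact hF _ _

theorem matWirtinger_congr {ε : ℂ} {A : κ} {F F' : (κ → ℂ) → Matrix ι ι' ℂ} {x : κ → ℂ}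
    (h : F =ᶠ[nhds x] F') : matWirtinger ε A F x = matWirtinger ε A F' x := by
  ext i j
  exact wirtinger_congr (h.mono fun y hy => by simp only [hy])

theorem matWirtinger_eventuallyEq {ε : ℂ} {A : κ} {F F' : (κ → ℂ) → Matrix ι ι' ℂ} {x : κ → ℂ}
    (h : F =ᶠ[nhds x] F') : matWirtinger ε A F =ᶠ[nhds x] matWirtinger ε A F' :=
  h.eventuallyEq_nhds.mono fun _ hy => matWirtinger_congr hy

theorem SmoothAt.congr {F F' : (κ → ℂ) → Matrix ι ι' ℂ} {x : κ → ℂ}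
    (hF : SmoothAt F x) (h : F' =ᶠ[nhds x] F) : SmoothAt F' x :=
  fun i j => (hF i j).congr_of_eventuallyEq (h.mono fun y hy => by simp only [hy])

@[simp]
theorem matWirtinger_const (ε : ℂ) (A : κ) (C : Matrix ι ι' ℂ) (x : κ → ℂ) :
    matWirtinger ε A (fun _ => C) x = 0 := by
  ext i j
  simp

theorem matWirtinger_neg {ε : ℂ} {A : κ} {F : (κ → ℂ) → Matrix ι ι' ℂ} {x : κ → ℂ} :
    matWirtinger ε A (fun y => - F y) x = - matWirtinger ε A F x := by
  ext i j
  exact wirtinger_neg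

theorem matWirtinger_add {ε : ℂ} {A : κ} {F F' : (κ → ℂ) → Matrix ι ι' ℂ} {x : κ → ℂ}
    (hF : SmoothAt F x) (hF' : SmoothAt F' x) : matWirtinger ε A (fun y => F y + F' y) x
      = matWirtinger ε A F x + matWirtinger ε A F' x := by
  ext i j
  exact wirtinger_add (hF.differentiableAt i j) (hF'.differentiableAt i j)

theorem matWirtinger_mul [Fintype ι'] {ε : ℂ} {A : κ} {F : (κ → ℂ) → Matrix ι ι' ℂ}
    {K : (κ → ℂ) → Matrix ι' ι'' ℂ} {x : κ → ℂ} (hF : SmoothAt F x) (hK : SmoothAt K x) :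
    matWirtinger ε A (fun y => F y * K y) x
      = matWirtinger ε A F x * K x + F x * matWirtinger ε A K x := by
  ext i j
  simp only [matWirtinger_apply, Matrix.add_apply, Matrix.mul_apply]
  rw [wirtinger_sum fun k _ => (hF.differentiableAt i k).fun_mul (hK.differentiableAt k j),
    ← Finset.sum_add_distrib]
  exact Finset.sum_congr rfl fun k _ =>
    wirtinger_mul (hF.differentiableAt i k) (hK.differentiableAt k j)

theorem matWirtinger_mul_const [Fintype ι'] {ε : ℂ} {A : κ} {F : (κ → ℂ) → Matrix ι ι' ℂ}
    {K : Matrix ι' ι'' ℂ} {x : κ → ℂ} (hF : SmoothAt F x) :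
    matWirtinger ε A (fun y => F y * K) x = matWirtinger ε A F x * K := by
  simp [matWirtinger_mul hF (smoothAt_const K x)]

theorem matWirtinger_const_mul [Fintype ι'] {ε : ℂ} {A : κ} {F : Matrix ι ι' ℂ}
    {K : (κ → ℂ) → Matrix ι' ι'' ℂ} {x : κ → ℂ} (hK : SmoothAt K x) :
    matWirtinger ε A (fun y => F * K y) x = F * matWirtinger ε A K x := by
  simp [matWirtinger_mul (smoothAt_const F x) hK]

theorem eventually_isUnit [Fintype ι] [DecidableEq ι] {F : (κ → ℂ) → Matrix ι ι ℂ} {x : κ → ℂ}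
    (hF : SmoothAt F x) (hx : IsUnit (F x)) : ∀ᶠ y in nhds x, IsUnit (F y) := by
  simp only [Matrix.isUnit_iff_isUnit_det, isUnit_iff_ne_zero] at hx ⊢
  exact (contDiffAt_det hF).continuousAt.eventually_ne hx

/-- Differentiate `F⁻¹ F = 1`, which holds near `x` because invertibility is an open condition. -/
theorem matWirtinger_inv [Fintype ι] [DecidableEq ι] {ε : ℂ} {A : κ}
    {F : (κ → ℂ) → Matrix ι ι ℂ} {x : κ → ℂ} (hF : SmoothAt F x) (hx : IsUnit (F x)) :
    matWirtinger ε A (fun y => (F y)⁻¹) x = - ((F x)⁻¹ * matWirtinger ε A F x * (F x)⁻¹) := by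
  have h0 : matWirtinger ε A (fun y => (F y)⁻¹ * F y) x = 0 := by
    rw [matWirtinger_congr (F' := fun _ => 1), matWirtinger_const]
    exact (eventually_isUnit hF hx).mono fun y hy =>
      Matrix.nonsing_inv_mul _ ((Matrix.isUnit_iff_isUnit_det _).mp hy)
  rw [matWirtinger_mul (hF.inv hx) hF] at h0
  have hm : F x * (F x)⁻¹ = 1 := Matrix.mul_nonsing_inv _ ((Matrix.isUnit_iff_isUnit_det _).mp hx)
  have := congrArg (· * (F x)⁻¹) (eq_neg_of_add_eq_zero_left h0)
  simpa only [Matrix.mul_assoc, hm, Matrix.mul_one, Matrix.neg_mul] using this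

theorem matWirtinger_comm {ε ε' : ℂ} {A B : κ} {F : (κ → ℂ) → Matrix ι ι' ℂ} {x : κ → ℂ}
    (hF : SmoothAt F x) : matWirtinger ε A (matWirtinger ε' B F) x
      = matWirtinger ε' B (matWirtinger ε A F) x := by
  ext i j
  exact wirtinger_comm (hF i j)

/-- The curvature matrix `-∂_A∂_B̄ H + ∂_A H · H⁻¹ · ∂_B̄ H` of a Hermitian metric. -/
def curvMatrix [Fintype ι] [DecidableEq ι] (H : (κ → ℂ) → Matrix ι ι ℂ) (A B : κ) (x : κ → ℂ) :
    Matrix ι ι ℂ :=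
  - matWirtinger (-1) A (matWirtinger 1 B H) x
    + matWirtinger (-1) A H x * (H x)⁻¹ * matWirtinger 1 B H x

theorem curvCoeff_eq_curvMatrix {ι : Type} [Fintype ι] [DecidableEq ι]
    (H : (κ → ℂ) → Matrix ι ι ℂ) (i j : ι) (A B : κ) (x : κ → ℂ) :
    curvCoeff H i j A B x = curvMatrix H A B x i j := by
  simp only [curvCoeff, dz_eq_wirtinger, dzbar_eq_wirtinger, curvMatrix, Matrix.add_apply,
    Matrix.neg_apply, Matrix.mul_apply, matWirtinger_apply, Finset.sum_mul]
  refine congrArg₂ _ (by rfl) (Finset.sum_congr rfl fun k _ => Finset.sum_congr rfl fun l _ => ?_)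
  ring

/-- The Chern curvature is ∂̄ of the connection matrix `∂H · H⁻¹`; multiplying by `H` lowers the
index. It serves both the tensoriality of the curvature and the first term of (ii). -/
theorem matWirtinger_connection_mul [Fintype ι] [DecidableEq ι] {H : (κ → ℂ) → Matrix ι ι ℂ}
    {A B : κ} {x : κ → ℂ} (hH : SmoothAt H x) (hx : IsUnit (H x)) :
    matWirtinger 1 B (fun y => matWirtinger (-1) A H y * (H y)⁻¹) x * H x
      = - curvMatrix H A B x := by
  have hm : (H x)⁻¹ * H x = 1 := Matrix.nonsing_inv_mul _ ((Matrix.isUnit_iff_isUnit_det _).mp hx)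
  rw [matWirtinger_mul hH.matWirtinger (hH.inv hx), matWirtinger_inv hH hx, curvMatrix,
    matWirtinger_comm hH]
  simp only [Matrix.add_mul, Matrix.mul_neg, Matrix.neg_mul, Matrix.mul_assoc, hm, Matrix.mul_one]
  abel

theorem curvMatrix_conjTranspose [Fintype ι] [DecidableEq ι] {H : (κ → ℂ) → Matrix ι ι ℂ}
    {A B : κ} {x : κ → ℂ} (hH : SmoothAt H x) (hherm : ∀ᶠ y in nhds x, (H y).IsHermitian) :
    (curvMatrix H A B x).conjTranspose = curvMatrix H B A x := by
  -- Stated at every point where `H` is Hermitian nearby, so that it can itself be differentiated in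
  -- `h2`.
  have h1 : ∀ ε C, ∀ y, (∀ᶠ y' in nhds y, (H y').IsHermitian) → conj ε = ε →
      (matWirtinger ε C H y).conjTranspose = matWirtinger (-ε) C H y := by
    intro ε C y hy hε
    ext i j
    simp only [Matrix.conjTranspose_apply, matWirtinger_apply]
    rw [wirtinger_congr (f := fun y => H y i j) (f' := fun y => conj (H y j i)), wirtinger_conj]
    · simp [hε]
    · exact hy.mono fun y' hy' => (hy'.apply i j).symm
  have h2 : (matWirtinger (-1) A (matWirtinger 1 B H) x).conjTranspose
      = matWirtinger (-1) B (matWirtinger 1 A H) x := by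
    rw [matWirtinger_comm (A := B) hH]
    ext i j
    simp only [Matrix.conjTranspose_apply, matWirtinger_apply]
    rw [wirtinger_congr (ε := 1) (A := A) (f' := fun y => conj (wirtinger 1 B (fun y => H y j i) y)),
      wirtinger_conj]
    · simp
    · refine hherm.eventually_nhds.mono fun y hy => ?_
      have := congrFun (congrFun (h1 1 B y hy (by simp)) i) j
      simpa using this.symm
  simp only [curvMatrix, Matrix.conjTranspose_add, Matrix.conjTranspose_neg, h2,
    Matrix.conjTranspose_mul, h1 (-1) A x hherm (by simp), h1 1 B x hherm (by simp),
    Matrix.conjTranspose_nonsing_inv, hherm.self_of_nhds.eq, neg_neg, Matrix.mul_assoc]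

/-- Tensoriality of the Chern curvature. -/
theorem herm_chernCurvature {ι : Type} [Fintype ι] [DecidableEq ι] {H : (κ → ℂ) → Matrix ι ι ℂ}
    {x : κ → ℂ} (hH : SmoothAt H x) (hx : IsUnit (H x)) (X Y : κ → ℂ)
    {s : (κ → ℂ) → ι → ℂ} (hs : ∀ i, ContDiffAt ℝ ∞ (fun y => s y i) x) (t : ι → ℂ) :
    herm (H x) (chernCurvature H X Y s x) t
      = ∑ A, ∑ B, (∑ i, ∑ j, s x i * curvMatrix H A B x i j * conj (t j)) * X A * conj (Y B) := by
  have hd : ∀ i, DifferentiableAt ℝ (fun y => s y i) x := fun i => (hs i).differentiableAt (by simp)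
  -- The second derivatives of `s` cancel by symmetry and the terms `∂̄s · Γ` cancel each other;
  -- only `-s · ∂̄Γ` remains.
  have key : ∀ A B k, chernNabla H A (dbarSection B s) x k - dbarSection B (chernNabla H A s) x k
      = - ∑ i, s x i *
          matWirtinger 1 B (fun y => matWirtinger (-1) A H y * (H y)⁻¹) x i k := by
    intro A B k
    have hΓ : SmoothAt (fun y => matWirtinger (-1) A H y * (H y)⁻¹) x :=
      hH.matWirtinger.mul (hH.inv hx)
    have e1 : ∀ y i, ∑ j, dz A (fun y => H y i j) y * (H y)⁻¹ j k
        = (matWirtinger (-1) A H y * (H y)⁻¹) i k := by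
      intro y i
      simp [Matrix.mul_apply, dz_eq_wirtinger]
    simp only [chernNabla, dbarSection, e1]
    simp only [dz_eq_wirtinger, dzbar_eq_wirtinger]
    rw [wirtinger_add ((contDiffAt_wirtinger (hs k)).differentiableAt (by simp))
        (DifferentiableAt.fun_sum fun i _ => (hd i).fun_mul (hΓ.differentiableAt i k)),
      wirtinger_sum fun i _ => (hd i).fun_mul (hΓ.differentiableAt i k)]
    have e2 : ∀ i, wirtinger 1 B
          (fun y => s y i * (matWirtinger (-1) A H y * (H y)⁻¹) i k) x
        = wirtinger 1 B (fun y => s y i) x * (matWirtinger (-1) A H x * (H x)⁻¹) i k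
          + s x i * matWirtinger 1 B (fun y => matWirtinger (-1) A H y * (H y)⁻¹) x i k :=
      fun i => wirtinger_mul (hd i) (hΓ.differentiableAt i k)
    simp only [e2, Finset.sum_add_distrib]
    have e3 := wirtinger_comm (ε := -1) (ε' := 1) (A := A) (B := B) (hs k)
    change wirtinger (-1) A (wirtinger 1 B fun y => s y k) x + _
      - (wirtinger 1 B (wirtinger (-1) A fun y => s y k) x + _) = _
    rw [e3]
    ring
  have key2 : ∀ A B i j,
      ∑ k, - matWirtinger 1 B (fun y => matWirtinger (-1) A H y * (H y)⁻¹) x i k * H x k j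
        = curvMatrix H A B x i j := by
    intro A B i j
    have := congrFun (congrFun (matWirtinger_connection_mul (A := A) (B := B) hH hx) i) j
    rw [Matrix.mul_apply, Matrix.neg_apply] at this
    simp only [neg_mul, Finset.sum_neg_distrib, this, neg_neg]
  have rev : ∀ f : ι → ι → ι → ℂ, ∑ k, ∑ j, ∑ i, f i j k = ∑ i, ∑ j, ∑ k, f i j k := by
    intro f
    rw [Finset.sum_comm, Finset.sum_comm (f := fun i j => ∑ k, f i j k)]
    exact Finset.sum_congr rfl fun j _ => Finset.sum_comm
  simp only [herm, chernCurvature, key, ← key2]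
  simp only [Finset.mul_sum, Finset.sum_mul, ← Finset.sum_neg_distrib]
  simp only [Finset.sum_comm (s := (Finset.univ : Finset ι)) (t := (Finset.univ : Finset κ))]
  refine Finset.sum_congr rfl fun A _ => Finset.sum_congr rfl fun B _ => ?_
  rw [rev]
  refine Finset.sum_congr rfl fun i _ => Finset.sum_congr rfl fun j _ =>
    Finset.sum_congr rfl fun k _ => ?_
  ring

end MatrixCalculus

/-! ### Curvature and orthogonal decompositions -/

section Decomposition

variable {κ : Type} [Fintype κ] [DecidableEq κ] {ι ν ρ : Type*}
  [Fintype ι] [DecidableEq ι] [Fintype ν] [DecidableEq ν] [Fintype ρ] [DecidableEq ρ]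
  {Ω : (κ → ℂ) → Matrix ι ι ℂ} {Q : (κ → ℂ) → Matrix ν ν ℂ} {d : (κ → ℂ) → Matrix ρ ρ ℂ}
  {T : (κ → ℂ) → Matrix ν ι ℂ} {S : (κ → ℂ) → Matrix ι ν ℂ}
  {E : Matrix ν ι ℂ} {E' : Matrix ι ν ℂ} {F : Matrix ρ ι ℂ} {F' : Matrix ι ρ ℂ} {x : κ → ℂ}

/-- The curvature of a quotient bundle: `T` are the components of the orthogonal lift of a
holomorphic frame of the quotient (with projection `E'` and metric `Q`), `S` their conjugates. -/
theorem mul_curvMatrix_mul_of_quotient (hΩ : ∀ᶠ y in nhds x, SmoothAt Ω y)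
    (hQ : ∀ᶠ y in nhds x, SmoothAt Q y) (hT : ∀ᶠ y in nhds x, SmoothAt T y)
    (hS : SmoothAt S x) (uΩ : IsUnit (Ω x)) (uQ : IsUnit (Q x))
    (hTΩ : (fun y => T y * Ω y) =ᶠ[nhds x] fun y => Q y * E)
    (hΩS : (fun y => Ω y * S y) =ᶠ[nhds x] fun y => E' * Q y)
    (hTE : ∀ᶠ y in nhds x, T y * E' = 1) (hES : ∀ᶠ y in nhds x, E * S y = 1) (A B : κ) :
    T x * curvMatrix Ω A B x * S x = curvMatrix Q A B x
      - matWirtinger 1 B T x * Ω x * matWirtinger (-1) A S x := by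
  have hΩx : SmoothAt Ω x := hΩ.self_of_nhds
  have hQx : SmoothAt Q x := hQ.self_of_nhds
  have hTx : SmoothAt T x := hT.self_of_nhds
  -- `E'` is constant and `T E' = 1`, so the derivatives of the lift are killed by the projection:
  -- they lie in the subbundle.
  have dT' : ∀ ε C, ∀ᶠ y in nhds x, matWirtinger ε C T y * E' = 0 := by
    intro ε C
    filter_upwards [hT, hTE.eventually_nhds] with y hTy hy
    rw [← matWirtinger_mul_const hTy, matWirtinger_congr (F' := fun _ => 1) hy, matWirtinger_const]
  have dT : ∀ ε C, matWirtinger ε C T x * E' = 0 := fun ε C => (dT' ε C).self_of_nhds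
  have dS : ∀ ε C, E * matWirtinger ε C S x = 0 := by
    intro ε C
    rw [← matWirtinger_const_mul hS, matWirtinger_congr (F' := fun _ => 1) hES, matWirtinger_const]
  have ddT : matWirtinger (-1) A (matWirtinger 1 B T) x * E' = 0 := by
    rw [← matWirtinger_mul_const hTx.matWirtinger, matWirtinger_congr (F' := fun _ => 0) (dT' 1 B),
      matWirtinger_const]
  have l1 : ∀ ε C, T x * matWirtinger ε C Ω x = matWirtinger ε C Q x * E
      - matWirtinger ε C T x * Ω x := by
    intro ε C
    have := matWirtinger_congr (ε := ε) (A := C) hTΩ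
    rw [matWirtinger_mul hTx hΩx, matWirtinger_mul_const hQx] at this
    rw [← this]; abel
  have r1 : ∀ ε C, matWirtinger ε C Ω x * S x = E' * matWirtinger ε C Q x
      - Ω x * matWirtinger ε C S x := by
    intro ε C
    have := matWirtinger_congr (ε := ε) (A := C) hΩS
    rw [matWirtinger_mul hΩx hS, matWirtinger_const_mul hQx] at this
    rw [← this]; abel
  have l2 : T x * matWirtinger (-1) A (matWirtinger 1 B Ω) x
      = matWirtinger (-1) A (matWirtinger 1 B Q) x * E
        - matWirtinger (-1) A (matWirtinger 1 B T) x * Ω x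
        - matWirtinger 1 B T x * matWirtinger (-1) A Ω x
        - matWirtinger (-1) A T x * matWirtinger 1 B Ω x := by
    have hl : matWirtinger 1 B (fun y => T y * Ω y) =ᶠ[nhds x]
        fun y => matWirtinger 1 B T y * Ω y + T y * matWirtinger 1 B Ω y := by
      filter_upwards [hT, hΩ] with y h1 h2 using matWirtinger_mul h1 h2
    have hr : matWirtinger 1 B (fun y => Q y * E) =ᶠ[nhds x] fun y => matWirtinger 1 B Q y * E := by
      filter_upwards [hQ] with y h1 using matWirtinger_mul_const h1
    have := matWirtinger_congr (ε := -1) (A := A)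
      (hl.symm.trans ((matWirtinger_eventuallyEq hTΩ).trans hr))
    rw [matWirtinger_mul_const hQx.matWirtinger, matWirtinger_add (hTx.matWirtinger.mul hΩx)
      (hTx.mul hΩx.matWirtinger), matWirtinger_mul hTx.matWirtinger hΩx,
      matWirtinger_mul hTx hΩx.matWirtinger] at this
    rw [← this]
    abel
  have hTΩx : T x * Ω x = Q x * E := hTΩ.self_of_nhds
  have hx1 : Ω x * (Ω x)⁻¹ = 1 := Matrix.mul_nonsing_inv _ ((Matrix.isUnit_iff_isUnit_det _).mp uΩ)
  have hx2 : (Ω x)⁻¹ * Ω x = 1 := Matrix.nonsing_inv_mul _ ((Matrix.isUnit_iff_isUnit_det _).mp uΩ)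
  have hq2 : (Q x)⁻¹ * Q x = 1 := Matrix.nonsing_inv_mul _ ((Matrix.isUnit_iff_isUnit_det _).mp uQ)
  -- The dual of the quotient metric is the restriction of the dual metric.
  have hinv : E * (Ω x)⁻¹ * E' = (Q x)⁻¹ := by
    have h1 : E = (Q x)⁻¹ * T x * Ω x := by
      rw [Matrix.mul_assoc, hTΩx, ← Matrix.mul_assoc, hq2, Matrix.one_mul]
    rw [h1, Matrix.mul_assoc _ (Ω x), hx1, Matrix.mul_one, Matrix.mul_assoc, hTE.self_of_nhds,
      Matrix.mul_one]
  have hΩSx : Ω x * S x = E' * Q x := hΩS.self_of_nhds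
  -- The term `∂_A T · Ω · ∂̄_B S` occurs here and in `p2` and cancels in the curvature; the other
  -- one, `∂̄_B T · Ω · ∂_A S`, is the second fundamental form term.
  have p1 : T x * matWirtinger (-1) A (matWirtinger 1 B Ω) x * S x
      = matWirtinger (-1) A (matWirtinger 1 B Q) x
        + matWirtinger 1 B T x * Ω x * matWirtinger (-1) A S x
        + matWirtinger (-1) A T x * Ω x * matWirtinger 1 B S x := by
    rw [l2]
    simp only [Matrix.sub_mul, Matrix.mul_assoc, hES.self_of_nhds, hΩSx, r1, Matrix.mul_sub]
    simp only [← Matrix.mul_assoc, ddT, dT, Matrix.zero_mul, Matrix.mul_one]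
    abel
  have p2 : T x * (matWirtinger (-1) A Ω x * (Ω x)⁻¹ * matWirtinger 1 B Ω x) * S x
      = matWirtinger (-1) A Q x * (Q x)⁻¹ * matWirtinger 1 B Q x
        + matWirtinger (-1) A T x * Ω x * matWirtinger 1 B S x := by
    have : T x * (matWirtinger (-1) A Ω x * (Ω x)⁻¹ * matWirtinger 1 B Ω x) * S x
        = (T x * matWirtinger (-1) A Ω x) * (Ω x)⁻¹ * (matWirtinger 1 B Ω x * S x) := by
      simp only [Matrix.mul_assoc]
    rw [this, l1, r1, ← hinv]
    simp only [Matrix.sub_mul, Matrix.mul_sub]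
    have e1 : matWirtinger (-1) A Q x * E * (Ω x)⁻¹ * (Ω x * matWirtinger 1 B S x) = 0 := by
      rw [Matrix.mul_assoc _ (Ω x)⁻¹, ← Matrix.mul_assoc (Ω x)⁻¹, hx2, Matrix.one_mul,
        Matrix.mul_assoc, dS, Matrix.mul_zero]
    have e2 : matWirtinger (-1) A T x * Ω x * (Ω x)⁻¹ * (E' * matWirtinger 1 B Q x) = 0 := by
      rw [Matrix.mul_assoc _ (Ω x), hx1, Matrix.mul_one, ← Matrix.mul_assoc, dT,
        Matrix.zero_mul]
    have e3 : matWirtinger (-1) A T x * Ω x * (Ω x)⁻¹ * (Ω x * matWirtinger 1 B S x)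
        = matWirtinger (-1) A T x * Ω x * matWirtinger 1 B S x := by
      rw [Matrix.mul_assoc _ (Ω x) (Ω x)⁻¹, hx1, Matrix.mul_one, ← Matrix.mul_assoc]
    rw [e1, e2, e3]
    simp only [Matrix.mul_assoc, sub_zero, zero_sub, sub_neg_eq_add]
  rw [curvMatrix, Matrix.mul_add, Matrix.add_mul, Matrix.mul_neg, Matrix.neg_mul, p1, p2, curvMatrix]
  abel

/-- The curvature of a holomorphic subbundle: here `F` is a constant frame of the subbundle with
metric `d`. -/
theorem mul_curvMatrix_mul_of_sub (hΩ : ∀ᶠ y in nhds x, SmoothAt Ω y)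
    (hd : (fun y => F * Ω y * F') =ᶠ[nhds x] d)
    (hinv : (Ω x)⁻¹ = S x * (Q x)⁻¹ * T x + F' * (d x)⁻¹ * F) (A B : κ) :
    F * curvMatrix Ω A B x * F' = curvMatrix d A B x
      + (F * matWirtinger (-1) A Ω x * S x) * (Q x)⁻¹ * (T x * matWirtinger 1 B Ω x * F') := by
  have hd' : ∀ ε C, (fun y => F * matWirtinger ε C Ω y * F') =ᶠ[nhds x] matWirtinger ε C d := by
    intro ε C
    refine Filter.EventuallyEq.trans ?_ (matWirtinger_eventuallyEq hd)
    filter_upwards [hΩ] with y hy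
    rw [matWirtinger_mul_const ((smoothAt_const F y).mul hy), matWirtinger_const_mul hy]
  have hΩx : SmoothAt Ω x := hΩ.self_of_nhds
  have h1 : F * matWirtinger (-1) A (matWirtinger 1 B Ω) x * F'
      = matWirtinger (-1) A (matWirtinger 1 B d) x := by
    rw [← matWirtinger_congr (hd' 1 B),
      matWirtinger_mul_const ((smoothAt_const F x).mul hΩx.matWirtinger),
      matWirtinger_const_mul hΩx.matWirtinger]
  -- Splitting `Ω⁻¹` in the quadratic term, the part along the subbundle completes the curvature of
  -- `d`, and the orthogonal part is the correction. The lifts are never differentiated.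
  rw [curvMatrix, curvMatrix, Matrix.mul_add, Matrix.add_mul, Matrix.mul_neg, Matrix.neg_mul, h1,
    hinv, ← (hd' (-1) A).self_of_nhds, ← (hd' 1 B).self_of_nhds]
  simp only [Matrix.mul_add, Matrix.add_mul, Matrix.mul_assoc]
  abel

end Decomposition

/-! ### Functions on the total space in the coordinates `(z, v)` -/

section Coordinates

variable {n r : ℕ}

theorem contDiff_zPart : ContDiff ℝ ∞ (zPart : (Fin n ⊕ Fin r → ℂ) → Fin n → ℂ) :=
  contDiff_pi.2 fun α => contDiff_apply ℝ ℂ (Sum.inl α)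

theorem contDiff_vPart (i : Fin r) : ContDiff ℝ ∞ (fun x : Fin n ⊕ Fin r → ℂ => vPart x i) :=
  contDiff_apply ℝ ℂ (Sum.inr i)

theorem contDiff_conj_vPart (i : Fin r) :
    ContDiff ℝ ∞ (fun x : Fin n ⊕ Fin r → ℂ => conj (vPart x i)) :=
  Complex.conjCLE.contDiff.comp (contDiff_vPart i)

theorem contDiffAt_comp_zPart {f : (Fin n → ℂ) → ℂ} {x : Fin n ⊕ Fin r → ℂ}
    (hf : ContDiffAt ℝ ∞ f (zPart x)) : ContDiffAt ℝ ∞ (fun y => f (zPart y)) x :=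
  hf.comp x contDiff_zPart.contDiffAt

theorem fderiv_comp_zPart {f : (Fin n → ℂ) → ℂ} {x : Fin n ⊕ Fin r → ℂ}
    (hf : DifferentiableAt ℝ f (zPart x)) (w : Fin n ⊕ Fin r → ℂ) :
    fderiv ℝ (fun y => f (zPart y)) x w = fderiv ℝ f (zPart x) (zPart w) := by
  let L : (Fin n ⊕ Fin r → ℂ) →L[ℝ] (Fin n → ℂ) :=
    ContinuousLinearMap.pi fun α => ContinuousLinearMap.proj (Sum.inl α)
  have h : HasFDerivAt (zPart : (Fin n ⊕ Fin r → ℂ) → Fin n → ℂ) L x := L.hasFDerivAt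
  exact congrArg (fun K => K w) (hf.hasFDerivAt.comp x h).fderiv

theorem wirtinger_inl_comp_zPart {f : (Fin n → ℂ) → ℂ} {x : Fin n ⊕ Fin r → ℂ}
    (hf : DifferentiableAt ℝ f (zPart x)) (ε : ℂ) (α : Fin n) :
    wirtinger ε (Sum.inl α) (fun y => f (zPart y)) x = wirtinger ε α f (zPart x) := by
  have h : ∀ a : ℂ, zPart (Pi.single (Sum.inl α) a : Fin n ⊕ Fin r → ℂ) = Pi.single α a := by
    intro a
    funext β
    simp [zPart, Pi.single_apply]
  simp only [wirtinger, fderiv_comp_zPart hf, h]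

theorem wirtinger_inr_comp_zPart {f : (Fin n → ℂ) → ℂ} {x : Fin n ⊕ Fin r → ℂ}
    (hf : DifferentiableAt ℝ f (zPart x)) (ε : ℂ) (i : Fin r) :
    wirtinger ε (Sum.inr i) (fun y => f (zPart y)) x = 0 := by
  have h : ∀ a : ℂ, zPart (Pi.single (Sum.inr i) a : Fin n ⊕ Fin r → ℂ) = 0 := by
    intro a
    funext β
    simp [zPart]
  simp [wirtinger, fderiv_comp_zPart hf, h]

variable {x : Fin n ⊕ Fin r → ℂ}

theorem wirtinger_inl_mul_vPart {f : (Fin n → ℂ) → ℂ} (hf : ContDiffAt ℝ ∞ f (zPart x))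
    (ε : ℂ) (α : Fin n) (i : Fin r) :
    wirtinger ε (Sum.inl α) (fun y => f (zPart y) * vPart y i) x
      = wirtinger ε α f (zPart x) * vPart x i := by
  have h0 : wirtinger ε (Sum.inl α) (fun y : Fin n ⊕ Fin r → ℂ => vPart y i) x = 0 := by
    simp [vPart, wirtinger_coord]
  rw [wirtinger_mul ((contDiffAt_comp_zPart hf).differentiableAt (by simp))
    ((contDiff_vPart i).contDiffAt.differentiableAt (by simp)),
    wirtinger_inl_comp_zPart (hf.differentiableAt (by simp)), h0, mul_zero, add_zero]

theorem wirtinger_inr_mul_vPart {f : (Fin n → ℂ) → ℂ} (hf : ContDiffAt ℝ ∞ f (zPart x))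
    (ε : ℂ) (k i : Fin r) :
    wirtinger ε (Sum.inr k) (fun y => f (zPart y) * vPart y i) x
      = if k = i then f (zPart x) * ((1 - ε) / 2) else 0 := by
  have h0 : wirtinger ε (Sum.inr k) (fun y : Fin n ⊕ Fin r → ℂ => vPart y i) x
      = if k = i then (1 - ε) / 2 else 0 := by
    simp [vPart, wirtinger_coord]
  rw [wirtinger_mul ((contDiffAt_comp_zPart hf).differentiableAt (by simp))
    ((contDiff_vPart i).contDiffAt.differentiableAt (by simp)),
    wirtinger_inr_comp_zPart (hf.differentiableAt (by simp)), h0, zero_mul, zero_add, mul_ite,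
    mul_zero]

theorem wirtinger_inl_mul_conj_vPart {f : (Fin n → ℂ) → ℂ} (hf : ContDiffAt ℝ ∞ f (zPart x))
    (ε : ℂ) (α : Fin n) (i : Fin r) :
    wirtinger ε (Sum.inl α) (fun y => f (zPart y) * conj (vPart y i)) x
      = wirtinger ε α f (zPart x) * conj (vPart x i) := by
  have h0 : wirtinger ε (Sum.inl α) (fun y : Fin n ⊕ Fin r → ℂ => conj (vPart y i)) x = 0 := by
    simp [vPart, wirtinger_conj_coord]
  rw [wirtinger_mul ((contDiffAt_comp_zPart hf).differentiableAt (by simp))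
    ((contDiff_conj_vPart i).contDiffAt.differentiableAt (by simp)),
    wirtinger_inl_comp_zPart (hf.differentiableAt (by simp)), h0, mul_zero, add_zero]

theorem wirtinger_inr_mul_conj_vPart {f : (Fin n → ℂ) → ℂ} (hf : ContDiffAt ℝ ∞ f (zPart x))
    (ε : ℂ) (k i : Fin r) :
    wirtinger ε (Sum.inr k) (fun y => f (zPart y) * conj (vPart y i)) x
      = if k = i then f (zPart x) * ((1 + ε) / 2) else 0 := by
  have h0 : wirtinger ε (Sum.inr k) (fun y : Fin n ⊕ Fin r → ℂ => conj (vPart y i)) x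
      = if k = i then (1 + ε) / 2 else 0 := by
    simp [vPart, wirtinger_conj_coord]
  rw [wirtinger_mul ((contDiffAt_comp_zPart hf).differentiableAt (by simp))
    ((contDiff_conj_vPart i).contDiffAt.differentiableAt (by simp)),
    wirtinger_inr_comp_zPart (hf.differentiableAt (by simp)), h0, zero_mul, zero_add, mul_ite,
    mul_zero]

theorem contDiffAt_mul_vPart {f : (Fin n → ℂ) → ℂ} (hf : ContDiffAt ℝ ∞ f (zPart x)) (i : Fin r) :
    ContDiffAt ℝ ∞ (fun y => f (zPart y) * vPart y i) x :=
  (contDiffAt_comp_zPart hf).mul (contDiff_vPart i).contDiffAt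

theorem contDiffAt_mul_conj_vPart {f : (Fin n → ℂ) → ℂ} (hf : ContDiffAt ℝ ∞ f (zPart x))
    (i : Fin r) : ContDiffAt ℝ ∞ (fun y => f (zPart y) * conj (vPart y i)) x :=
  (contDiffAt_comp_zPart hf).mul (contDiff_conj_vPart i).contDiffAt

theorem contDiffAt_sesq {F : (Fin n → ℂ) → Matrix (Fin r) (Fin r) ℂ} (hF : SmoothAt F (zPart x)) :
    ContDiffAt ℝ ∞ (fun y => ∑ i, ∑ j, F (zPart y) i j * vPart y i * conj (vPart y j)) x :=
  ContDiffAt.sum fun i _ => ContDiffAt.sum fun j _ =>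
    (contDiffAt_mul_vPart (hF i j) i).mul (contDiff_conj_vPart j).contDiffAt

theorem wirtinger_sesq_aux {F : (Fin n → ℂ) → Matrix (Fin r) (Fin r) ℂ}
    (hF : SmoothAt F (zPart x)) (ε : ℂ) (A : Fin n ⊕ Fin r) :
    wirtinger ε A (fun y => ∑ i, ∑ j, F (zPart y) i j * vPart y i * conj (vPart y j)) x
      = ∑ i, ∑ j, (wirtinger ε A (fun y => F (zPart y) i j * vPart y i) x * conj (vPart x j)
        + F (zPart x) i j * vPart x i * wirtinger ε A (fun y => conj (vPart y j)) x) := by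
  have h1 : ∀ i j, DifferentiableAt ℝ (fun y => F (zPart y) i j * vPart y i) x := fun i j =>
    (contDiffAt_mul_vPart (hF i j) i).differentiableAt (by simp)
  have h2 : ∀ j, DifferentiableAt ℝ (fun y : Fin n ⊕ Fin r → ℂ => conj (vPart y j)) x := fun j =>
    (contDiff_conj_vPart j).contDiffAt.differentiableAt (by simp)
  rw [wirtinger_sum fun i _ => DifferentiableAt.fun_sum fun j _ => (h1 i j).fun_mul (h2 j)]
  refine Finset.sum_congr rfl fun i _ => ?_
  rw [wirtinger_sum fun j _ => (h1 i j).fun_mul (h2 j)]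
  exact Finset.sum_congr rfl fun j _ => wirtinger_mul (h1 i j) (h2 j)

theorem wirtinger_inl_sesq {F : (Fin n → ℂ) → Matrix (Fin r) (Fin r) ℂ}
    (hF : SmoothAt F (zPart x)) (ε : ℂ) (α : Fin n) :
    wirtinger ε (Sum.inl α)
        (fun y => ∑ i, ∑ j, F (zPart y) i j * vPart y i * conj (vPart y j)) x
      = ∑ i, ∑ j, matWirtinger ε α F (zPart x) i j * vPart x i * conj (vPart x j) := by
  have h0 : ∀ j, wirtinger ε (Sum.inl α) (fun y : Fin n ⊕ Fin r → ℂ => conj (vPart y j)) x = 0 := by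
    simp [vPart, wirtinger_conj_coord]
  rw [wirtinger_sesq_aux hF]
  simp only [h0, wirtinger_inl_mul_vPart (hF _ _), mul_zero, add_zero, matWirtinger_apply]

/-- The weights are selectors: ε = -1 differentiates only `v`, ε = 1 only `v̄`. -/
theorem wirtinger_inr_sesq {F : (Fin n → ℂ) → Matrix (Fin r) (Fin r) ℂ}
    (hF : SmoothAt F (zPart x)) (ε : ℂ) (k : Fin r) :
    wirtinger ε (Sum.inr k)
        (fun y => ∑ i, ∑ j, F (zPart y) i j * vPart y i * conj (vPart y j)) x
      = (1 - ε) / 2 * ∑ j, F (zPart x) k j * conj (vPart x j)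
        + (1 + ε) / 2 * ∑ i, F (zPart x) i k * vPart x i := by
  have h0 : ∀ j, wirtinger ε (Sum.inr k) (fun y : Fin n ⊕ Fin r → ℂ => conj (vPart y j)) x
      = if k = j then (1 + ε) / 2 else 0 := by
    simp [vPart, wirtinger_conj_coord]
  rw [wirtinger_sesq_aux hF]
  simp only [h0, wirtinger_inr_mul_vPart (hF _ _), Finset.sum_add_distrib, ite_mul, zero_mul,
    mul_ite, mul_zero, Finset.sum_ite_eq, Finset.mem_univ, if_true]
  rw [Finset.sum_comm]
  simp only [Finset.sum_ite_eq, Finset.mem_univ, if_true, Finset.mul_sum]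
  refine congrArg₂ _ (Finset.sum_congr rfl fun i _ => ?_) (Finset.sum_congr rfl fun i _ => ?_) <;>
  ring

end Coordinates

/-! ### The metric on the total space in block form -/

section Blocks

variable {n r : ℕ}

/-- The function `h_{ij̄} v^i v̄^j`. -/
def sesqPotential (h : (Fin n → ℂ) → Matrix (Fin r) (Fin r) ℂ) (y : Fin n ⊕ Fin r → ℂ) : ℂ :=
  ∑ i, ∑ j, h (zPart y) i j * vPart y i * conj (vPart y j)

/-- The coefficients of `π^*ω + i∂∂̄h`. -/
def totalMetric (g : (Fin n → ℂ) → Matrix (Fin n) (Fin n) ℂ)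
    (h : (Fin n → ℂ) → Matrix (Fin r) (Fin r) ℂ) (x : Fin n ⊕ Fin r → ℂ) :
    Matrix (Fin n ⊕ Fin r) (Fin n ⊕ Fin r) ℂ :=
  Matrix.fromBlocks (g (zPart x)) 0 0 0
    + Matrix.of fun A B => dz A (dzbar B (sesqPotential h)) x

/-- The coefficients `∂_α∂_β̄ h_{ij̄} v^i v̄^j`. -/
def leviBase (h : (Fin n → ℂ) → Matrix (Fin r) (Fin r) ℂ) (x : Fin n ⊕ Fin r → ℂ) :
    Matrix (Fin n) (Fin n) ℂ :=
  Matrix.of fun α β => ∑ i, ∑ j,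
    matWirtinger (-1) α (matWirtinger 1 β h) (zPart x) i j * vPart x i * conj (vPart x j)

/-- The coefficients `∂_α h_{il̄} v^i`. -/
def leviMixed (h : (Fin n → ℂ) → Matrix (Fin r) (Fin r) ℂ) (x : Fin n ⊕ Fin r → ℂ) :
    Matrix (Fin n) (Fin r) ℂ :=
  Matrix.of fun α l => ∑ i, matWirtinger (-1) α h (zPart x) i l * vPart x i

/-- The coefficients `∂_β̄ h_{kj̄} v̄^j`. -/
def leviMixed' (h : (Fin n → ℂ) → Matrix (Fin r) (Fin r) ℂ) (x : Fin n ⊕ Fin r → ℂ) :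
    Matrix (Fin r) (Fin n) ℂ :=
  Matrix.of fun k β => ∑ j, matWirtinger 1 β h (zPart x) k j * conj (vPart x j)

/-- The coefficients `g_{αβ̄} - R_{ij̄αβ̄} v^i v̄^j`. -/
def horMetric (g : (Fin n → ℂ) → Matrix (Fin n) (Fin n) ℂ)
    (h : (Fin n → ℂ) → Matrix (Fin r) (Fin r) ℂ) (x : Fin n ⊕ Fin r → ℂ) :
    Matrix (Fin n) (Fin n) ℂ :=
  Matrix.of fun α β =>
    -(∑ i, ∑ j, curvCoeff h i j α β (zPart x) * vPart x i * conj (vPart x j)) + g (zPart x) α β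

variable {g : (Fin n → ℂ) → Matrix (Fin n) (Fin n) ℂ}
  {h : (Fin n → ℂ) → Matrix (Fin r) (Fin r) ℂ} {x : Fin n ⊕ Fin r → ℂ}

/-- The potential is bilinear in `v` and `v̄`, so each fibre derivative strips one factor.
Smoothness near the point is needed because the first derivative is differentiated again. -/
theorem totalMetric_eq_fromBlocks (hh : ∀ᶠ z in nhds (zPart x), SmoothAt h z) :
    totalMetric g h x = Matrix.fromBlocks (g (zPart x) + leviBase h x) (leviMixed h x)
      (leviMixed' h x) (h (zPart x)) := by
  have hev : ∀ᶠ y in nhds x, SmoothAt h (zPart y) :=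
    contDiff_zPart.continuous.continuousAt.eventually hh
  have hx : SmoothAt h (zPart x) := hh.self_of_nhds
  have h1 : ∀ β, dzbar (Sum.inl β) (sesqPotential h) =ᶠ[nhds x]
      fun y => ∑ i, ∑ j, matWirtinger 1 β h (zPart y) i j * vPart y i * conj (vPart y j) := by
    intro β
    filter_upwards [hev] with y hy
    rw [dzbar_eq_wirtinger]
    exact wirtinger_inl_sesq hy 1 β
  have h2 : ∀ l, dzbar (Sum.inr l) (sesqPotential h) =ᶠ[nhds x]
      fun y => ∑ i, h (zPart y) i l * vPart y i := by
    intro l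
    filter_upwards [hev] with y hy
    rw [dzbar_eq_wirtinger]
    refine (wirtinger_inr_sesq hy 1 l).trans ?_
    norm_num
  have hd : ∀ i l, DifferentiableAt ℝ (fun y => h (zPart y) i l * vPart y i) x := fun i l =>
    (contDiffAt_mul_vPart (hx i l) i).differentiableAt (by simp)
  ext A B
  simp only [totalMetric, dz_eq_wirtinger, Matrix.add_apply, Matrix.of_apply]
  rcases A with α | k <;> rcases B with β | l
  · rw [wirtinger_congr (h1 β), wirtinger_inl_sesq hx.matWirtinger]
    rfl
  · rw [wirtinger_congr (h2 l), wirtinger_sum fun i _ => hd i l]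
    simp only [wirtinger_inl_mul_vPart (hx _ _)]
    simp [leviMixed]
  · rw [wirtinger_congr (h1 β), wirtinger_inr_sesq hx.matWirtinger]
    norm_num [leviMixed']
  · rw [wirtinger_congr (h2 l), wirtinger_sum fun i _ => hd i l]
    simp only [wirtinger_inr_mul_vPart (hx _ _)]
    norm_num

theorem smoothAt_comp_zPart {ι ι' : Type*} {F : (Fin n → ℂ) → Matrix ι ι' ℂ}
    (hF : SmoothAt F (zPart x)) : SmoothAt (fun y => F (zPart y)) x :=
  fun i j => contDiffAt_comp_zPart (hF i j)

theorem smoothAt_leviBase (hh : SmoothAt h (zPart x)) : SmoothAt (leviBase h) x :=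
  fun _ _ => contDiffAt_sesq hh.matWirtinger.matWirtinger

theorem smoothAt_leviMixed (hh : SmoothAt h (zPart x)) : SmoothAt (leviMixed h) x := by
  intro α l
  simp only [leviMixed, Matrix.of_apply]
  exact ContDiffAt.sum fun i _ => contDiffAt_mul_vPart (hh.matWirtinger _ _) i

theorem smoothAt_leviMixed' (hh : SmoothAt h (zPart x)) : SmoothAt (leviMixed' h) x := by
  intro α l
  simp only [leviMixed', Matrix.of_apply]
  exact ContDiffAt.sum fun i _ => contDiffAt_mul_conj_vPart (hh.matWirtinger _ _) i

theorem matWirtinger_inl_leviMixed (hh : SmoothAt h (zPart x)) (ε : ℂ) (γ : Fin n) (α : Fin n)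
    (l : Fin r) : matWirtinger ε (Sum.inl γ) (leviMixed h) x α l
      = ∑ i, matWirtinger ε γ (matWirtinger (-1) α h) (zPart x) i l * vPart x i := by
  have hs : ∀ i, ContDiffAt ℝ ∞ (fun z => matWirtinger (-1) α h z i l) (zPart x) :=
    fun i => hh.matWirtinger i l
  simp only [matWirtinger_apply ε (Sum.inl γ), leviMixed, Matrix.of_apply]
  rw [wirtinger_sum fun i _ => (contDiffAt_mul_vPart (hs i) i).differentiableAt (by simp)]
  exact Finset.sum_congr rfl fun i _ => wirtinger_inl_mul_vPart (hs i) ε γ i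

/-- The mixed block is linear in `v` and free of `v̄`. This is why the second fundamental form has
no vertical components. -/
theorem matWirtinger_inr_leviMixed (hh : SmoothAt h (zPart x)) (k : Fin r) :
    matWirtinger 1 (Sum.inr k) (leviMixed h) x = 0 := by
  ext α l
  have hs : ∀ i, ContDiffAt ℝ ∞ (fun z => matWirtinger (-1) α h z i l) (zPart x) :=
    fun i => hh.matWirtinger i l
  simp only [matWirtinger_apply 1 (Sum.inr k), leviMixed, Matrix.of_apply]
  rw [wirtinger_sum fun i _ => (contDiffAt_mul_vPart (hs i) i).differentiableAt (by simp)]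
  exact Finset.sum_eq_zero fun i _ => (wirtinger_inr_mul_vPart (hs i) 1 k i).trans (by simp)

theorem matWirtinger_inl_leviMixed' (hh : SmoothAt h (zPart x)) (ε : ℂ) (γ : Fin n) (k : Fin r)
    (β : Fin n) : matWirtinger ε (Sum.inl γ) (leviMixed' h) x k β
      = ∑ j, matWirtinger ε γ (matWirtinger 1 β h) (zPart x) k j * conj (vPart x j) := by
  have hs : ∀ j, ContDiffAt ℝ ∞ (fun z => matWirtinger 1 β h z k j) (zPart x) :=
    fun j => hh.matWirtinger k j
  simp only [matWirtinger_apply ε (Sum.inl γ), leviMixed', Matrix.of_apply]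
  rw [wirtinger_sum fun i _ => (contDiffAt_mul_conj_vPart (hs i) i).differentiableAt (by simp)]
  exact Finset.sum_congr rfl fun i _ => wirtinger_inl_mul_conj_vPart (hs i) ε γ i

theorem matWirtinger_inr_leviMixed' (hh : SmoothAt h (zPart x)) (k : Fin r) :
    matWirtinger (-1) (Sum.inr k) (leviMixed' h) x = 0 := by
  ext l β
  have hs : ∀ i, ContDiffAt ℝ ∞ (fun z => matWirtinger 1 β h z l i) (zPart x) :=
    fun i => hh.matWirtinger l i
  simp only [matWirtinger_apply (-1) (Sum.inr k), leviMixed', Matrix.of_apply]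
  rw [wirtinger_sum fun i _ => (contDiffAt_mul_conj_vPart (hs i) i).differentiableAt (by simp)]
  exact Finset.sum_eq_zero fun i _ => (wirtinger_inr_mul_conj_vPart (hs i) (-1) k i).trans (by simp)

theorem matWirtinger_inl_comp_zPart {ι ι' : Type*} {F : (Fin n → ℂ) → Matrix ι ι' ℂ}
    (hF : SmoothAt F (zPart x)) (ε : ℂ) (γ : Fin n) :
    matWirtinger ε (Sum.inl γ) (fun y => F (zPart y)) x = matWirtinger ε γ F (zPart x) := by
  ext i j
  exact wirtinger_inl_comp_zPart (hF.differentiableAt i j) ε γ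

theorem matWirtinger_inr_comp_zPart {ι ι' : Type*} {F : (Fin n → ℂ) → Matrix ι ι' ℂ}
    (hF : SmoothAt F (zPart x)) (ε : ℂ) (k : Fin r) :
    matWirtinger ε (Sum.inr k) (fun y => F (zPart y)) x = 0 := by
  ext i j
  exact wirtinger_inr_comp_zPart (hF.differentiableAt i j) ε k

/-- In `-R v v̄` the term `∂∂̄h` contributes `leviBase`, and `∂h h⁻¹ ∂̄h` contributes the product of
the mixed blocks through `h⁻¹`. So `g - R v v̄` is the metric induced on the quotient by the
vertical bundle. -/
theorem horMetric_eq_schur : horMetric g h x = g (zPart x) + leviBase h x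
    - leviMixed h x * (h (zPart x))⁻¹ * leviMixed' h x := by
  ext α β
  have e : (leviMixed h x * (h (zPart x))⁻¹ * leviMixed' h x) α β
      = ∑ i, ∑ j, (matWirtinger (-1) α h (zPart x) * (h (zPart x))⁻¹
          * matWirtinger 1 β h (zPart x)) i j * vPart x i * conj (vPart x j) := by
    -- The row index of the mixed block is the direction of differentiation; fixing it turns the
    -- triple product into a chain of vector-matrix products.
    have l1 : ∀ l, leviMixed h x α l
        = Matrix.vecMul (vPart x) (matWirtinger (-1) α h (zPart x)) l := by
      intro l
      simp [leviMixed, Matrix.vecMul, dotProduct, mul_comm]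
    have l2 : ∀ k, leviMixed' h x k β
        = Matrix.mulVec (matWirtinger 1 β h (zPart x)) (fun j => conj (vPart x j)) k := by
      intro k
      simp [leviMixed', Matrix.mulVec, dotProduct]
    have l3 : (leviMixed h x * (h (zPart x))⁻¹ * leviMixed' h x) α β
        = Matrix.vecMul (Matrix.vecMul (vPart x) (matWirtinger (-1) α h (zPart x)))
            (h (zPart x))⁻¹ ⬝ᵥ
          Matrix.mulVec (matWirtinger 1 β h (zPart x)) (fun j => conj (vPart x j)) := by
      simp only [Matrix.mul_apply, l1, l2]
      rfl
    rw [l3, Matrix.vecMul_vecMul, Matrix.dotProduct_mulVec, Matrix.vecMul_vecMul,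
      ← Matrix.dotProduct_mulVec]
    simp only [dotProduct, Matrix.mulVec, Finset.mul_sum]
    refine Finset.sum_congr rfl fun i _ => Finset.sum_congr rfl fun j _ => ?_
    ring
  simp only [horMetric, Matrix.of_apply, curvCoeff_eq_curvMatrix, curvMatrix, Matrix.add_apply,
    Matrix.sub_apply, Matrix.neg_apply, e, leviBase, add_mul, neg_mul, Finset.sum_add_distrib,
    Finset.sum_neg_distrib]
  ring

end Blocks

/-! ### Linear algebra of block matrices -/

section BlockAlgebra

open Matrix

variable {ν ρ : Type*} [Fintype ν] [DecidableEq ν] [Fintype ρ] [DecidableEq ρ]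
  {a q : Matrix ν ν ℂ} {b : Matrix ν ρ ℂ} {c : Matrix ρ ν ℂ} {d : Matrix ρ ρ ℂ}

theorem inv_mul_of_isUnit (hd : IsUnit d) : d⁻¹ * d = 1 :=
  Matrix.nonsing_inv_mul _ ((Matrix.isUnit_iff_isUnit_det _).mp hd)

theorem mul_inv_of_isUnit (hd : IsUnit d) : d * d⁻¹ = 1 :=
  Matrix.mul_nonsing_inv _ ((Matrix.isUnit_iff_isUnit_det _).mp hd)

/-- The rows of the lift are orthogonal to the fibre directions, and their pairing with the base
directions is the Schur complement. -/
theorem lift_mul_fromBlocks (hd : IsUnit d) (hq : q = a - b * d⁻¹ * c) :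
    fromCols (1 : Matrix ν ν ℂ) (-(b * d⁻¹)) * fromBlocks a b c d = q * fromCols (1 : Matrix ν ν ℂ) (0 : Matrix ν ρ ℂ) := by
  rw [fromCols_mul_fromBlocks, mul_fromCols]
  congr 1
  · rw [hq]; simp [sub_eq_add_neg]
  · simp [Matrix.mul_assoc, inv_mul_of_isUnit hd]

theorem fromBlocks_mul_lift (hd : IsUnit d) (hq : q = a - b * d⁻¹ * c) :
    fromBlocks a b c d * fromRows (1 : Matrix ν ν ℂ) (-(d⁻¹ * c)) = fromRows (1 : Matrix ν ν ℂ) (0 : Matrix ρ ν ℂ) * q := by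
  rw [fromBlocks_mul_fromRows, fromRows_mul]
  congr 1
  · rw [hq]; simp [sub_eq_add_neg, Matrix.mul_assoc]
  · simp [← Matrix.mul_assoc, mul_inv_of_isUnit hd]

/-- The inverse metric splits along the orthogonal decomposition into the lifted inverse of `q` and
the inverse of the fibre metric `d`; this is the form in which the subbundle formula uses it. -/
theorem fromBlocks_mul_schur_inv (hd : IsUnit d) (uq : IsUnit q) (hq : q = a - b * d⁻¹ * c) :
    fromBlocks a b c d * (fromRows (1 : Matrix ν ν ℂ) (-(d⁻¹ * c)) * q⁻¹ * fromCols (1 : Matrix ν ν ℂ) (-(b * d⁻¹))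
      + fromRows (0 : Matrix ν ρ ℂ) (1 : Matrix ρ ρ ℂ) * d⁻¹
        * fromCols (0 : Matrix ρ ν ℂ) (1 : Matrix ρ ρ ℂ)) = 1 := by
  rw [Matrix.mul_add, ← Matrix.mul_assoc, ← Matrix.mul_assoc, fromBlocks_mul_lift hd hq,
    Matrix.mul_assoc (fromRows (1 : Matrix ν ν ℂ) (0 : Matrix ρ ν ℂ)) q, mul_inv_of_isUnit uq, Matrix.mul_one, ← Matrix.mul_assoc,
    ← Matrix.mul_assoc, fromBlocks_mul_fromRows]
  ext (i | i) (j | j) <;>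
    simp [fromRows_mul, mul_inv_of_isUnit hd, Matrix.one_apply]

theorem isUnit_fromBlocks_of_schur (hd : IsUnit d) (uq : IsUnit q) (hq : q = a - b * d⁻¹ * c) :
    IsUnit (fromBlocks a b c d) :=
  IsUnit.of_mul_eq_one _ (fromBlocks_mul_schur_inv hd uq hq)

theorem inv_fromBlocks_of_schur (hd : IsUnit d) (uq : IsUnit q) (hq : q = a - b * d⁻¹ * c) :
    (fromBlocks a b c d)⁻¹ = fromRows (1 : Matrix ν ν ℂ) (-(d⁻¹ * c)) * q⁻¹ * fromCols (1 : Matrix ν ν ℂ) (-(b * d⁻¹))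
      + fromRows (0 : Matrix ν ρ ℂ) (1 : Matrix ρ ρ ℂ) * d⁻¹
        * fromCols (0 : Matrix ρ ν ℂ) (1 : Matrix ρ ρ ℂ) :=
  Matrix.inv_eq_right_inv (fromBlocks_mul_schur_inv hd uq hq)

/-- The Schur criterion gives semidefiniteness; invertibility upgrades it to definiteness. -/
theorem posDef_fromBlocks_of_schur (hd : d.PosDef) (hq : (a - b * d⁻¹ * bᴴ).PosDef) :
    (fromBlocks a b bᴴ d).PosDef := by
  have : Invertible d := hd.isUnit.invertible
  exact ((PosDef.fromBlocks₂₂ a b hd).2 hq.posSemidef).posDef_iff_isUnit.2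
    (isUnit_fromBlocks_of_schur hd.isUnit hq.isUnit rfl)

/-- With `q = m + g` and `a = m q⁻¹` one has `g q⁻¹ = 1 - a` and `a q = m`, so `(1 - a) m (1 - a)ᴴ +
a (q - m) aᴴ` collapses to `m - a m`. The difference thereby becomes a sum of congruences of `m` and
`g`, whose signs are known. -/
theorem sub_mul_inv_mul_eq {m g : Matrix ν ν ℂ} (hm : m.IsHermitian) (hg : (m + g).PosDef) :
    m - m * (m + g)⁻¹ * m = (g * (m + g)⁻¹) * m * (g * (m + g)⁻¹)ᴴ
      + (m * (m + g)⁻¹) * g * (m * (m + g)⁻¹)ᴴ := by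
  set q := m + g with hq
  have h1 : q * q⁻¹ = 1 := mul_inv_of_isUnit hg.isUnit
  have h2 : q⁻¹ * q = 1 := inv_mul_of_isUnit hg.isUnit
  have hgq : g = q - m := by rw [hq]; abel
  have h3 : g * q⁻¹ = 1 - m * q⁻¹ := by rw [hgq, Matrix.sub_mul, h1]
  have h4 : (m * q⁻¹)ᴴ = q⁻¹ * m := by
    rw [conjTranspose_mul, conjTranspose_nonsing_inv, hg.1.eq, hm.eq]
  rw [h3, conjTranspose_sub, h4, conjTranspose_one, hgq]
  have h5 : m * q⁻¹ * q = m := by rw [Matrix.mul_assoc, h2, Matrix.mul_one]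
  simp only [Matrix.sub_mul, Matrix.mul_sub, Matrix.one_mul, Matrix.mul_one, h5]
  simp only [← Matrix.mul_assoc]
  abel

theorem posSemidef_sub_mul_inv_mul {m g : Matrix ν ν ℂ} (hm : m.PosSemidef) (hg : g.PosDef) :
    (m - m * (m + g)⁻¹ * m).PosSemidef := by
  rw [sub_mul_inv_mul_eq hm.1 (PosDef.posSemidef_add hm hg)]
  exact (hm.mul_mul_conjTranspose_same _).add (hg.posSemidef.mul_mul_conjTranspose_same _)

/-- The congruence of `m` is by the invertible matrix `g (m + g)⁻¹`, so that summand alone is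
already definite. -/
theorem posDef_sub_mul_inv_mul {m g : Matrix ν ν ℂ} (hm : m.PosDef) (hg : g.PosDef) :
    (m - m * (m + g)⁻¹ * m).PosDef := by
  have hq := PosDef.posSemidef_add hm.posSemidef hg
  rw [sub_mul_inv_mul_eq hm.1 hq]
  refine PosDef.add_posSemidef (hm.mul_mul_conjTranspose_same ?_)
    (hg.posSemidef.mul_mul_conjTranspose_same _)
  exact Matrix.vecMul_injective_of_isUnit (hg.isUnit.mul hq.inv.isUnit)

end BlockAlgebra

/-! ### The local form of the theorem -/

section LocalTheorem

open Matrix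

variable {n r : ℕ}

/-- Local data on an open set of `ℂⁿ`: a Kähler metric `g` and a Griffiths negative Hermitian
metric `h` on a trivial bundle. -/
structure IsNegativePair (g : (Fin n → ℂ) → Matrix (Fin n) (Fin n) ℂ)
    (h : (Fin n → ℂ) → Matrix (Fin r) (Fin r) ℂ) (U : Set (Fin n → ℂ)) : Prop where
  isOpen : IsOpen U
  kahler : IsKahlerOn g U
  smooth : ∀ z ∈ U, SmoothAt h z
  posDef : ∀ z ∈ U, (h z).PosDef
  negative : ∀ z ∈ U, ∀ v : Fin r → ℂ, v ≠ 0 → ∀ ξ : Fin n → ℂ, ξ ≠ 0 →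
    (∑ i, ∑ j, ∑ α, ∑ β,
      curvCoeff h i j α β z * v i * conj (v j) * ξ α * conj (ξ β)).re < 0

/-- The coefficients `-R_{ij̄αβ̄} v^i v̄^j`. -/
def negCurvForm (h : (Fin n → ℂ) → Matrix (Fin r) (Fin r) ℂ) (x : Fin n ⊕ Fin r → ℂ) :
    Matrix (Fin n) (Fin n) ℂ :=
  Matrix.of fun α β =>
    -(∑ i, ∑ j, curvCoeff h i j α β (zPart x) * vPart x i * conj (vPart x j))

/-- The rows are the components of the horizontal lifts `δ/δz^α`. -/
def horLift (h : (Fin n → ℂ) → Matrix (Fin r) (Fin r) ℂ) (x : Fin n ⊕ Fin r → ℂ) :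
    Matrix (Fin n) (Fin n ⊕ Fin r) ℂ :=
  fromCols 1 (-(leviMixed h x * (h (zPart x))⁻¹))

/-- The conjugate transpose of `horLift`, written without conjugation. -/
def horLift' (h : (Fin n → ℂ) → Matrix (Fin r) (Fin r) ℂ) (x : Fin n ⊕ Fin r → ℂ) :
    Matrix (Fin n ⊕ Fin r) (Fin n) ℂ :=
  fromRows 1 (-((h (zPart x))⁻¹ * leviMixed' h x))

/-- The coefficients `R_{kq̄ασ̄} v^k`. -/
def curvLeft (h : (Fin n → ℂ) → Matrix (Fin r) (Fin r) ℂ) (x : Fin n ⊕ Fin r → ℂ) (σ : Fin n) :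
    Matrix (Fin n) (Fin r) ℂ :=
  Matrix.of fun α q => ∑ k, curvCoeff h k q α σ (zPart x) * vPart x k

/-- The coefficients `R_{pl̄γβ̄} v̄^l`. -/
def curvRight (h : (Fin n → ℂ) → Matrix (Fin r) (Fin r) ℂ) (x : Fin n ⊕ Fin r → ℂ) (γ : Fin n) :
    Matrix (Fin r) (Fin n) ℂ :=
  Matrix.of fun p β => ∑ l, curvCoeff h p l γ β (zPart x) * conj (vPart x l)

theorem horMetric_eq {g : (Fin n → ℂ) → Matrix (Fin n) (Fin n) ℂ}
    {h : (Fin n → ℂ) → Matrix (Fin r) (Fin r) ℂ} {x : Fin n ⊕ Fin r → ℂ} :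
    horMetric g h x = negCurvForm h x + g (zPart x) := rfl

namespace IsNegativePair

variable {g : (Fin n → ℂ) → Matrix (Fin n) (Fin n) ℂ}
  {h : (Fin n → ℂ) → Matrix (Fin r) (Fin r) ℂ} {U : Set (Fin n → ℂ)}
  (hp : IsNegativePair g h U) {x : Fin n ⊕ Fin r → ℂ} (hx : zPart x ∈ U)

include hp hx

theorem eventually_mem : ∀ᶠ y in nhds x, zPart y ∈ U :=
  contDiff_zPart.continuous.continuousAt.eventually (hp.isOpen.mem_nhds hx)

theorem eventually_smooth : ∀ᶠ z in nhds (zPart x), SmoothAt h z :=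
  (hp.isOpen.eventually_mem hx).mono hp.smooth

theorem smoothAt_base : SmoothAt g (zPart x) :=
  fun α β => (hp.kahler.smooth α β).contDiffAt (hp.isOpen.mem_nhds hx)

theorem isUnit_fibre : IsUnit (h (zPart x)) := (hp.posDef _ hx).isUnit

theorem contDiffAt_potential : ContDiffAt ℝ ∞ (sesqPotential h) x :=
  contDiffAt_sesq (hp.smooth _ hx)

theorem smoothAt_totalMetric : SmoothAt (totalMetric g h) x := by
  intro A B
  simp only [totalMetric, dz_eq_wirtinger, dzbar_eq_wirtinger, Matrix.add_apply, Matrix.of_apply]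
  refine ContDiffAt.add ?_
    (contDiffAt_wirtinger (contDiffAt_wirtinger (hp.contDiffAt_potential hx)))
  rcases A with α | k <;> rcases B with β | l
  · exact contDiffAt_comp_zPart (hp.smoothAt_base hx α β)
  all_goals exact contDiffAt_const

theorem totalMetric_closed (A B C : Fin n ⊕ Fin r) :
    dz C (fun y => totalMetric g h y A B) x = dz A (fun y => totalMetric g h y C B) x := by
  have hg := hp.smoothAt_base hx
  have hbase : ∀ A B, ContDiffAt ℝ ∞ (fun y : Fin n ⊕ Fin r → ℂ =>
      fromBlocks (g (zPart y)) 0 0 (0 : Matrix (Fin r) (Fin r) ℂ) A B) x := by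
    rintro (α | k) (β | l)
    · exact contDiffAt_comp_zPart (hg α β)
    all_goals exact contDiffAt_const
  have hpot := hp.contDiffAt_potential hx
  have split : ∀ A C, dz C (fun y => totalMetric g h y A B) x
      = dz C (fun y => fromBlocks (g (zPart y)) 0 0 (0 : Matrix (Fin r) (Fin r) ℂ) A B) x
        + dz C (dz A (dzbar B (sesqPotential h))) x := by
    intro A C
    simp only [totalMetric, Matrix.add_apply, Matrix.of_apply]
    rw [dz_eq_wirtinger C]
    refine wirtinger_add ((hbase A B).differentiableAt (by simp)) ?_
    rw [dz_eq_wirtinger, dzbar_eq_wirtinger]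
    exact (contDiffAt_wirtinger (contDiffAt_wirtinger hpot)).differentiableAt (by simp)
  rw [split, split]
  congr 1
  · have hc := hp.kahler.closed _ hx
    simp only [dz_eq_wirtinger] at hc ⊢
    have hl : ∀ α β γ, wirtinger (-1) (Sum.inl γ : Fin n ⊕ Fin r) (fun y => g (zPart y) α β) x
        = wirtinger (-1) γ (fun z => g z α β) (zPart x) := fun α β γ =>
      wirtinger_inl_comp_zPart (hg.differentiableAt α β) _ _
    have hr : ∀ α β k, wirtinger (-1) (Sum.inr k : Fin n ⊕ Fin r) (fun y => g (zPart y) α β) x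
        = 0 := fun α β γ => wirtinger_inr_comp_zPart (hg.differentiableAt α β) _ _
    -- Unless all three indices are base indices, each side is the derivative of a zero block or a
    -- fibre derivative of `g`.
    rcases A with α | k <;> rcases B with β | l <;> rcases C with γ | m <;>
      simp only [fromBlocks_apply₁₁, fromBlocks_apply₁₂, fromBlocks_apply₂₁, fromBlocks_apply₂₂,
        Matrix.zero_apply, wirtinger_const, hl, hr]
    exact hc α β γ
  · simp only [dz_eq_wirtinger, dzbar_eq_wirtinger]
    exact wirtinger_comm (contDiffAt_wirtinger hpot)

theorem eventually_isHermitian : ∀ᶠ z in nhds (zPart x), (h z).IsHermitian :=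
  (hp.isOpen.eventually_mem hx).mono fun z hz => (hp.posDef z hz).1

theorem conj_curvCoeff (i j : Fin r) (α β : Fin n) :
    conj (curvCoeff h i j α β (zPart x)) = curvCoeff h j i β α (zPart x) := by
  rw [curvCoeff_eq_curvMatrix, curvCoeff_eq_curvMatrix,
    ← curvMatrix_conjTranspose (hp.smooth _ hx) (hp.eventually_isHermitian hx)]
  exact Complex.conj_conj _

theorem isHermitian_negCurvForm : (negCurvForm h x).IsHermitian := by
  ext α β
  simp only [negCurvForm, conjTranspose_apply, Matrix.of_apply, star_neg, star_sum, star_mul',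
    RCLike.star_def, hp.conj_curvCoeff hx, Complex.conj_conj]
  rw [Finset.sum_comm]
  refine congrArg _ (Finset.sum_congr rfl fun i _ => Finset.sum_congr rfl fun j _ => ?_)
  ring

theorem posDef_negCurvForm (hv : vPart x ≠ 0) : (negCurvForm h x).PosDef := by
  refine PosDef.of_dotProduct_mulVec_pos (hp.isHermitian_negCurvForm hx) fun w hw => ?_
  have him := (hp.isHermitian_negCurvForm hx).im_star_dotProduct_mulVec_self w
  -- The direction is `star w`: the matrix form conjugates its left vector, whereas ξ enters
  -- unconjugated through the left index α.
  have hneg := hp.negative _ hx (vPart x) hv (star w) (star_ne_zero.2 hw)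
  have e : star w ⬝ᵥ (negCurvForm h x *ᵥ w) = -(∑ i, ∑ j, ∑ α, ∑ β,
      curvCoeff h i j α β (zPart x) * vPart x i * conj (vPart x j) * star w α
        * conj (star w β)) := by
    simp only [dotProduct, mulVec, negCurvForm, Matrix.of_apply, Finset.mul_sum, neg_mul,
      mul_neg, Finset.sum_neg_distrib, Finset.sum_mul, Pi.star_apply, RCLike.star_def,
      Complex.conj_conj]
    simp only [Finset.sum_comm (s := (Finset.univ : Finset (Fin n)))
      (t := (Finset.univ : Finset (Fin r)))]
    refine congrArg _ (Finset.sum_congr rfl fun i _ => Finset.sum_congr rfl fun j _ =>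
      Finset.sum_congr rfl fun α _ => Finset.sum_congr rfl fun β _ => ?_)
    ring
  rw [Complex.lt_def]
  refine ⟨?_, him.symm⟩
  rw [e, Complex.neg_re, Complex.zero_re]
  linarith

theorem posSemidef_negCurvForm : (negCurvForm h x).PosSemidef := by
  by_cases hv : vPart x = 0
  · have : negCurvForm h x = 0 := by
      ext α β
      simp [negCurvForm, hv]
    rw [this]
    exact PosSemidef.zero
  · exact (hp.posDef_negCurvForm hx hv).posSemidef

theorem posDef_horMetric : (horMetric g h x).PosDef := by
  rw [horMetric_eq]
  exact PosDef.posSemidef_add (hp.posSemidef_negCurvForm hx) (hp.kahler.posDef _ hx)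

theorem conjTranspose_leviMixed : (leviMixed h x)ᴴ = leviMixed' h x := by
  ext l α
  simp only [leviMixed, leviMixed', conjTranspose_apply, Matrix.of_apply, star_sum, star_mul',
    matWirtinger_apply, RCLike.star_def]
  refine Finset.sum_congr rfl fun i _ => congrArg (· * _) ?_
  rw [wirtinger_congr (f := fun y => h y l i) (f' := fun y => conj (h y i l)), wirtinger_conj]
  · simp
  · exact (hp.eventually_isHermitian hx).mono fun y hy => (hy.apply l i).symm

theorem totalMetric_blocks : totalMetric g h x = fromBlocks (g (zPart x) + leviBase h x)
    (leviMixed h x) (leviMixed' h x) (h (zPart x)) :=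
  totalMetric_eq_fromBlocks (hp.eventually_smooth hx)

theorem posDef_totalMetric : (totalMetric g h x).PosDef := by
  rw [hp.totalMetric_blocks hx, ← hp.conjTranspose_leviMixed hx]
  refine posDef_fromBlocks_of_schur (hp.posDef _ hx) ?_
  rw [hp.conjTranspose_leviMixed hx, ← horMetric_eq_schur]
  exact hp.posDef_horMetric hx

theorem smoothAt_horLift : SmoothAt (horLift h) x := by
  have hN := ((smoothAt_leviMixed (hp.smooth _ hx)).mul
    ((smoothAt_comp_zPart (hp.smooth _ hx)).inv (hp.isUnit_fibre hx))).neg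
  rintro α (β | l)
  · exact contDiffAt_const
  · exact hN α l

theorem smoothAt_horLift' : SmoothAt (horLift' h) x := by
  have hN := (((smoothAt_comp_zPart (hp.smooth _ hx)).inv (hp.isUnit_fibre hx)).mul
    (smoothAt_leviMixed' (hp.smooth _ hx))).neg
  rintro (β | l) α
  · exact contDiffAt_const
  · exact hN l α

theorem conjTranspose_horLift : (horLift h x)ᴴ = horLift' h x := by
  rw [horLift, horLift', conjTranspose_fromCols_eq_fromRows_conjTranspose, conjTranspose_neg,
    conjTranspose_mul, hp.conjTranspose_leviMixed hx, conjTranspose_nonsing_inv,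
    (hp.posDef _ hx).1.eq, conjTranspose_one]

theorem smoothAt_horMetric : SmoothAt (horMetric g h) x := by
  have h0 := hp.smooth _ hx
  -- The Schur expression involves only blocks already known to be smooth.
  have e : horMetric g h = fun y => (g (zPart y) + leviBase h y)
      + -(leviMixed h y * (h (zPart y))⁻¹ * leviMixed' h y) := by
    funext y
    rw [horMetric_eq_schur, sub_eq_add_neg]
  rw [e]
  exact ((smoothAt_comp_zPart (hp.smoothAt_base hx)).add (smoothAt_leviBase h0)).add
    ((((smoothAt_leviMixed h0).mul ((smoothAt_comp_zPart h0).inv (hp.isUnit_fibre hx))).mul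
      (smoothAt_leviMixed' h0))).neg

/-- `∂_σ̄` of the mixed coefficients, covariantly. -/
theorem matWirtinger_inl_leviMixed_sub (σ : Fin n) :
    matWirtinger 1 (Sum.inl σ) (leviMixed h) x
      - leviMixed h x * (h (zPart x))⁻¹ * matWirtinger 1 σ h (zPart x) = - curvLeft h x σ := by
  ext α q
  have l1 : ∀ l, leviMixed h x α l
      = Matrix.vecMul (vPart x) (matWirtinger (-1) α h (zPart x)) l := by
    intro l
    simp [leviMixed, Matrix.vecMul, dotProduct, mul_comm]
  have l3 : (leviMixed h x * (h (zPart x))⁻¹ * matWirtinger 1 σ h (zPart x)) α q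
      = ∑ k, (matWirtinger (-1) α h (zPart x) * (h (zPart x))⁻¹
        * matWirtinger 1 σ h (zPart x)) k q * vPart x k := by
    have : (leviMixed h x * (h (zPart x))⁻¹ * matWirtinger 1 σ h (zPart x)) α q
        = (((vPart x ᵥ* matWirtinger (-1) α h (zPart x)) ᵥ* (h (zPart x))⁻¹)
          ᵥ* matWirtinger 1 σ h (zPart x)) q := by
      simp only [Matrix.mul_apply, l1]
      rfl
    rw [this, vecMul_vecMul, vecMul_vecMul]
    simp only [Matrix.vecMul, dotProduct, mul_comm, Matrix.mul_assoc]
  rw [Matrix.sub_apply, l3, matWirtinger_inl_leviMixed (hp.smooth _ hx)]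
  simp only [matWirtinger_comm (hp.smooth _ hx) (ε := 1) (ε' := -1), curvLeft, Matrix.neg_apply,
    Matrix.of_apply, curvCoeff_eq_curvMatrix, curvMatrix, Matrix.add_apply, add_mul, neg_mul,
    Finset.sum_add_distrib, Finset.sum_neg_distrib]
  ring

/-- Subtracting the connection term completes `∂∂̄h` to the full curvature, contracted with `v̄`.
This is the second fundamental form of the vertical bundle in base directions. -/
theorem matWirtinger_inl_leviMixed'_sub (γ : Fin n) :
    matWirtinger (-1) (Sum.inl γ) (leviMixed' h) x
      - matWirtinger (-1) γ h (zPart x) * ((h (zPart x))⁻¹ * leviMixed' h x)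
      = - curvRight h x γ := by
  ext p β
  have l1 : ∀ l, leviMixed' h x l β
      = (matWirtinger 1 β h (zPart x) *ᵥ fun j => conj (vPart x j)) l := by
    intro l
    simp [leviMixed', Matrix.mulVec, dotProduct]
  have l3 : (matWirtinger (-1) γ h (zPart x) * ((h (zPart x))⁻¹ * leviMixed' h x)) p β
      = ∑ l, (matWirtinger (-1) γ h (zPart x) * (h (zPart x))⁻¹
        * matWirtinger 1 β h (zPart x)) p l * conj (vPart x l) := by
    have : (matWirtinger (-1) γ h (zPart x) * ((h (zPart x))⁻¹ * leviMixed' h x)) p β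
        = (matWirtinger (-1) γ h (zPart x) *ᵥ ((h (zPart x))⁻¹ *ᵥ
          (matWirtinger 1 β h (zPart x) *ᵥ fun j => conj (vPart x j)))) p := by
      simp only [Matrix.mul_apply, l1]
      rfl
    rw [this, mulVec_mulVec, mulVec_mulVec]
    simp only [Matrix.mulVec, dotProduct, Matrix.mul_assoc]
  rw [Matrix.sub_apply, l3, matWirtinger_inl_leviMixed' (hp.smooth _ hx)]
  simp only [curvRight, Matrix.neg_apply,
    Matrix.of_apply, curvCoeff_eq_curvMatrix, curvMatrix, Matrix.add_apply, add_mul, neg_mul,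
    Finset.sum_add_distrib, Finset.sum_neg_distrib]
  ring

end IsNegativePair

end LocalTheorem

/-! ### Curvature of Ω on the vertical and horizontal bundles -/

section LocalCurvature

open Matrix

variable {n r : ℕ}

theorem matWirtinger_fromBlocks {κ : Type} [Fintype κ] [DecidableEq κ] {μ ν ρ τ : Type*}
    (ε : ℂ) (A : κ) (a : (κ → ℂ) → Matrix μ ρ ℂ) (b : (κ → ℂ) → Matrix μ τ ℂ)
    (c : (κ → ℂ) → Matrix ν ρ ℂ) (d : (κ → ℂ) → Matrix ν τ ℂ) (x : κ → ℂ) :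
    matWirtinger ε A (fun y => fromBlocks (a y) (b y) (c y) (d y)) x
      = fromBlocks (matWirtinger ε A a x) (matWirtinger ε A b x) (matWirtinger ε A c x)
        (matWirtinger ε A d x) := by
  ext (i | i) (j | j) <;> rfl

theorem curvMatrix_inl_comp_zPart {h : (Fin n → ℂ) → Matrix (Fin r) (Fin r) ℂ}
    {x : Fin n ⊕ Fin r → ℂ} (hh : ∀ᶠ z in nhds (zPart x), SmoothAt h z) (α σ : Fin n) :
    curvMatrix (fun y => h (zPart y)) (Sum.inl α) (Sum.inl σ) x = curvMatrix h α σ (zPart x) := by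
  have hx : SmoothAt h (zPart x) := hh.self_of_nhds
  have e : matWirtinger 1 (Sum.inl σ) (fun y : Fin n ⊕ Fin r → ℂ => h (zPart y)) =ᶠ[nhds x]
      fun y => matWirtinger 1 σ h (zPart y) :=
    (contDiff_zPart.continuous.continuousAt.eventually hh).mono fun y hy =>
      matWirtinger_inl_comp_zPart hy 1 σ
  rw [curvMatrix, curvMatrix, matWirtinger_congr e, matWirtinger_inl_comp_zPart hx,
    matWirtinger_inl_comp_zPart hx, matWirtinger_inl_comp_zPart hx.matWirtinger]

theorem curvMatrix_comp_zPart_inr_right {h : (Fin n → ℂ) → Matrix (Fin r) (Fin r) ℂ}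
    {x : Fin n ⊕ Fin r → ℂ} (hh : ∀ᶠ z in nhds (zPart x), SmoothAt h z) (A : Fin n ⊕ Fin r)
    (k : Fin r) : curvMatrix (fun y => h (zPart y)) A (Sum.inr k) x = 0 := by
  have e : matWirtinger 1 (Sum.inr k) (fun y : Fin n ⊕ Fin r → ℂ => h (zPart y)) =ᶠ[nhds x]
      fun _ => 0 :=
    (contDiff_zPart.continuous.continuousAt.eventually hh).mono fun y hy =>
      matWirtinger_inr_comp_zPart hy 1 k
  rw [curvMatrix, matWirtinger_congr e, matWirtinger_const, e.self_of_nhds]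
  simp

theorem curvMatrix_comp_zPart_inr_left {h : (Fin n → ℂ) → Matrix (Fin r) (Fin r) ℂ}
    {x : Fin n ⊕ Fin r → ℂ} (hh : ∀ᶠ z in nhds (zPart x), SmoothAt h z) (B : Fin n ⊕ Fin r)
    (k : Fin r) : curvMatrix (fun y => h (zPart y)) (Sum.inr k) B x = 0 := by
  have e : matWirtinger (-1) (Sum.inr k) (fun y : Fin n ⊕ Fin r → ℂ => h (zPart y)) =ᶠ[nhds x]
      fun _ => 0 :=
    (contDiff_zPart.continuous.continuousAt.eventually hh).mono fun y hy =>
      matWirtinger_inr_comp_zPart hy (-1) k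
  -- The derivatives are exchanged so that the vertical one, which vanishes identically near `x`,
  -- acts first.
  rw [curvMatrix, matWirtinger_comm (smoothAt_comp_zPart hh.self_of_nhds), matWirtinger_congr e,
    matWirtinger_const, e.self_of_nhds]
  simp

namespace IsNegativePair

variable {g : (Fin n → ℂ) → Matrix (Fin n) (Fin n) ℂ}
  {h : (Fin n → ℂ) → Matrix (Fin r) (Fin r) ℂ} {U : Set (Fin n → ℂ)}
  (hp : IsNegativePair g h U)

include hp in
theorem isKahlerOn_totalMetric :
    IsKahlerOn (totalMetric g h) {x : Fin n ⊕ Fin r → ℂ | zPart x ∈ U} where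
  smooth A B := fun _ hx => (hp.smoothAt_totalMetric hx A B).contDiffWithinAt
  posDef _ hx := hp.posDef_totalMetric hx
  closed _ hx A B C := hp.totalMetric_closed hx A B C

variable {x : Fin n ⊕ Fin r → ℂ} (hx : zPart x ∈ U)

include hp hx

theorem matWirtinger_totalMetric (ε : ℂ) (A : Fin n ⊕ Fin r) :
    matWirtinger ε A (totalMetric g h) x
      = fromBlocks (matWirtinger ε A (fun y => g (zPart y) + leviBase h y) x)
          (matWirtinger ε A (leviMixed h) x) (matWirtinger ε A (leviMixed' h) x)
          (matWirtinger ε A (fun y => h (zPart y)) x) := by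
  rw [← matWirtinger_fromBlocks]
  exact matWirtinger_congr ((hp.eventually_mem hx).mono fun y hy => hp.totalMetric_blocks hy)

/-- The subbundle formula for the constant frame `∂/∂v^i`. The two brackets are the second
fundamental form and its adjoint, kept for arbitrary directions so that base and fibre directions
can be read off separately. -/
theorem vertical_curvMatrix (A B : Fin n ⊕ Fin r) :
    (curvMatrix (totalMetric g h) A B x).toBlocks₂₂ = curvMatrix (fun y => h (zPart y)) A B x
      + (matWirtinger (-1) A (leviMixed' h) x
          - matWirtinger (-1) A (fun y => h (zPart y)) x * ((h (zPart x))⁻¹ * leviMixed' h x))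
        * (horMetric g h x)⁻¹
        * (matWirtinger 1 B (leviMixed h) x
          - leviMixed h x * (h (zPart x))⁻¹ * matWirtinger 1 B (fun y => h (zPart y)) x) := by
  -- Restriction to the constant vertical frame extracts the lower right block.
  have hb : ∀ m : Matrix (Fin n ⊕ Fin r) (Fin n ⊕ Fin r) ℂ,
      fromCols (0 : Matrix (Fin r) (Fin n) ℂ) (1 : Matrix (Fin r) (Fin r) ℂ) * m
        * fromRows (0 : Matrix (Fin n) (Fin r) ℂ) (1 : Matrix (Fin r) (Fin r) ℂ)
        = m.toBlocks₂₂ := by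
    intro m
    conv_lhs => rw [← fromBlocks_toBlocks m]
    rw [fromCols_mul_fromBlocks, fromCols_mul_fromRows]
    simp
  have key := mul_curvMatrix_mul_of_sub (Q := horMetric g h) (T := horLift h) (S := horLift' h)
    (d := fun y => h (zPart y))
    (F := fromCols (0 : Matrix (Fin r) (Fin n) ℂ) (1 : Matrix (Fin r) (Fin r) ℂ))
    (F' := fromRows (0 : Matrix (Fin n) (Fin r) ℂ) (1 : Matrix (Fin r) (Fin r) ℂ))
    ((hp.eventually_mem hx).mono fun y hy => hp.smoothAt_totalMetric hy)
    ((hp.eventually_mem hx).mono fun y hy => by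
      simp only [hb, hp.totalMetric_blocks hy, toBlocks_fromBlocks₂₂])
    (by
      rw [hp.totalMetric_blocks hx]
      exact inv_fromBlocks_of_schur (hp.isUnit_fibre hx) (hp.posDef_horMetric hx).isUnit
        horMetric_eq_schur) A B
  rw [hb] at key
  rw [key, hp.matWirtinger_totalMetric hx, hp.matWirtinger_totalMetric hx,
    fromCols_mul_fromBlocks, horLift', fromCols_mul_fromRows, horLift,
    Matrix.mul_assoc (fromCols _ _) (fromBlocks _ _ _ _) (fromRows _ _),
    fromBlocks_mul_fromRows, fromCols_mul_fromRows]
  simp [sub_eq_add_neg]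

theorem vertical_curvMatrix_inl (α σ : Fin n) :
    (curvMatrix (totalMetric g h) (Sum.inl α) (Sum.inl σ) x).toBlocks₂₂
      = curvMatrix h α σ (zPart x) + curvRight h x α * (horMetric g h x)⁻¹ * curvLeft h x σ := by
  rw [hp.vertical_curvMatrix hx, curvMatrix_inl_comp_zPart (hp.eventually_smooth hx),
    matWirtinger_inl_comp_zPart (hp.smooth _ hx), matWirtinger_inl_comp_zPart (hp.smooth _ hx),
    hp.matWirtinger_inl_leviMixed_sub hx, hp.matWirtinger_inl_leviMixed'_sub hx]
  simp

theorem vertical_curvMatrix_inr_left (k : Fin r) (B : Fin n ⊕ Fin r) :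
    (curvMatrix (totalMetric g h) (Sum.inr k) B x).toBlocks₂₂ = 0 := by
  rw [hp.vertical_curvMatrix hx, curvMatrix_comp_zPart_inr_left (hp.eventually_smooth hx),
    matWirtinger_inr_comp_zPart (hp.smooth _ hx), matWirtinger_inr_leviMixed' (hp.smooth _ hx)]
  simp

theorem vertical_curvMatrix_inr_right (A : Fin n ⊕ Fin r) (k : Fin r) :
    (curvMatrix (totalMetric g h) A (Sum.inr k) x).toBlocks₂₂ = 0 := by
  rw [hp.vertical_curvMatrix hx, curvMatrix_comp_zPart_inr_right (hp.eventually_smooth hx),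
    matWirtinger_inr_comp_zPart (hp.smooth _ hx) 1, matWirtinger_inr_leviMixed (hp.smooth _ hx)]
  simp

/-- The derivative of `h⁻¹` supplies exactly the connection term, so the lift varies vertically by
the second fundamental form with its index raised by `h⁻¹`. -/
theorem matWirtinger_horLift (B : Fin n ⊕ Fin r) :
    matWirtinger 1 B (horLift h) x = fromCols 0 (-((matWirtinger 1 B (leviMixed h) x
      - leviMixed h x * (h (zPart x))⁻¹ * matWirtinger 1 B (fun y => h (zPart y)) x)
        * (h (zPart x))⁻¹)) := by
  have h0 := smoothAt_comp_zPart (hp.smooth _ hx) (r := r)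
  have e : matWirtinger 1 B (horLift h) x = fromCols (matWirtinger 1 B (fun _ => 1) x)
      (matWirtinger 1 B (fun y => -(leviMixed h y * (h (zPart y))⁻¹)) x) := by
    ext α (β | l) <;> rfl
  rw [e, matWirtinger_const, matWirtinger_neg, matWirtinger_mul (smoothAt_leviMixed
    (hp.smooth _ hx)) (h0.inv (hp.isUnit_fibre hx)), matWirtinger_inv h0 (hp.isUnit_fibre hx)]
  simp only [sub_eq_add_neg, Matrix.add_mul, Matrix.neg_mul, Matrix.mul_neg, ← Matrix.mul_assoc]

theorem matWirtinger_horLift' (A : Fin n ⊕ Fin r) :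
    matWirtinger (-1) A (horLift' h) x = fromRows 0 (-((h (zPart x))⁻¹ *
      (matWirtinger (-1) A (leviMixed' h) x
      - matWirtinger (-1) A (fun y => h (zPart y)) x * ((h (zPart x))⁻¹ * leviMixed' h x)))) := by
  have h0 := smoothAt_comp_zPart (hp.smooth _ hx) (r := r)
  have e : matWirtinger (-1) A (horLift' h) x = fromRows (matWirtinger (-1) A (fun _ => 1) x)
      (matWirtinger (-1) A (fun y => -((h (zPart y))⁻¹ * leviMixed' h y)) x) := by
    ext (β | l) α <;> rfl
  rw [e, matWirtinger_const, matWirtinger_neg, matWirtinger_mul (h0.inv (hp.isUnit_fibre hx))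
    (smoothAt_leviMixed' (hp.smooth _ hx)), matWirtinger_inv h0 (hp.isUnit_fibre hx)]
  simp only [sub_eq_add_neg, Matrix.mul_add, Matrix.neg_mul, Matrix.mul_neg, ← Matrix.mul_assoc]
  rw [add_comm]

/-- The quotient formula. The derivatives of the lifts are vertical, so Ω between them reduces to
its fibre block, and `h⁻¹ h h⁻¹ = h⁻¹`. -/
theorem horizontal_curvMatrix (A B : Fin n ⊕ Fin r) :
    horLift h x * curvMatrix (totalMetric g h) A B x * horLift' h x
      = curvMatrix (horMetric g h) A B x
        - (matWirtinger 1 B (leviMixed h) x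
            - leviMixed h x * (h (zPart x))⁻¹ * matWirtinger 1 B (fun y => h (zPart y)) x)
          * (h (zPart x))⁻¹
          * (matWirtinger (-1) A (leviMixed' h) x
            - matWirtinger (-1) A (fun y => h (zPart y)) x
              * ((h (zPart x))⁻¹ * leviMixed' h x)) := by
  have hm := hp.eventually_mem hx
  have key := mul_curvMatrix_mul_of_quotient
    (E := fromCols (1 : Matrix (Fin n) (Fin n) ℂ) (0 : Matrix (Fin n) (Fin r) ℂ))
    (E' := fromRows (1 : Matrix (Fin n) (Fin n) ℂ) (0 : Matrix (Fin r) (Fin n) ℂ))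
    (hm.mono fun y hy => hp.smoothAt_totalMetric hy)
    (hm.mono fun y hy => hp.smoothAt_horMetric hy)
    (hm.mono fun y hy => hp.smoothAt_horLift hy) (hp.smoothAt_horLift' hx)
    (hp.posDef_totalMetric hx).isUnit (hp.posDef_horMetric hx).isUnit
    (hm.mono fun y hy => by
      simp only [hp.totalMetric_blocks hy]
      exact lift_mul_fromBlocks (hp.isUnit_fibre hy) horMetric_eq_schur)
    (hm.mono fun y hy => by
      simp only [hp.totalMetric_blocks hy]
      exact fromBlocks_mul_lift (hp.isUnit_fibre hy) horMetric_eq_schur)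
    (hm.mono fun y hy => by simp [horLift, fromCols_mul_fromRows])
    (hm.mono fun y hy => by simp [horLift', fromCols_mul_fromRows]) A B
  rw [key, hp.matWirtinger_horLift hx, hp.matWirtinger_horLift' hx, hp.totalMetric_blocks hx,
    fromCols_mul_fromBlocks, fromCols_mul_fromRows]
  have hu := mul_inv_of_isUnit (hp.isUnit_fibre hx)
  congr 1
  simp only [Matrix.zero_mul, zero_add, Matrix.mul_zero, Matrix.neg_mul, Matrix.mul_neg, neg_neg]
  simp only [Matrix.mul_assoc]
  rw [← Matrix.mul_assoc (h (zPart x)), hu, Matrix.one_mul]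

theorem horizontal_curvMatrix_inl (γ σ : Fin n) :
    horLift h x * curvMatrix (totalMetric g h) (Sum.inl γ) (Sum.inl σ) x * horLift' h x
      = curvMatrix (horMetric g h) (Sum.inl γ) (Sum.inl σ) x
        - curvLeft h x σ * (h (zPart x))⁻¹ * curvRight h x γ := by
  rw [hp.horizontal_curvMatrix hx, matWirtinger_inl_comp_zPart (hp.smooth _ hx),
    matWirtinger_inl_comp_zPart (hp.smooth _ hx),
    hp.matWirtinger_inl_leviMixed_sub hx, hp.matWirtinger_inl_leviMixed'_sub hx]
  simp

/-- The correction vanishes in fibre directions, but the curvature of the quotient metric need not,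
since that metric depends on `v`. Hence the first term of (ii) runs over all the variables. -/
theorem horizontal_curvMatrix_inr_left (k : Fin r) (B : Fin n ⊕ Fin r) :
    horLift h x * curvMatrix (totalMetric g h) (Sum.inr k) B x * horLift' h x
      = curvMatrix (horMetric g h) (Sum.inr k) B x := by
  rw [hp.horizontal_curvMatrix hx, matWirtinger_inr_comp_zPart (hp.smooth _ hx) (-1),
    matWirtinger_inr_leviMixed' (hp.smooth _ hx)]
  simp

theorem horizontal_curvMatrix_inr_right (A : Fin n ⊕ Fin r) (k : Fin r) :
    horLift h x * curvMatrix (totalMetric g h) A (Sum.inr k) x * horLift' h x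
      = curvMatrix (horMetric g h) A (Sum.inr k) x := by
  rw [hp.horizontal_curvMatrix hx, matWirtinger_inr_comp_zPart (hp.smooth _ hx) 1,
    matWirtinger_inr_leviMixed (hp.smooth _ hx)]
  simp

/-- `⟨R(∂/∂v^i), ∂/∂v^j⟩` contracted with the tautological section is `M Q⁻¹ M - M`. -/
theorem taut_curvMatrix (α σ : Fin n) :
    ∑ i, ∑ j, vPart x i * (curvMatrix (totalMetric g h) (Sum.inl α) (Sum.inl σ) x).toBlocks₂₂ i j
        * conj (vPart x j)
      = -(negCurvForm h x - negCurvForm h x * (negCurvForm h x + g (zPart x))⁻¹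
        * negCurvForm h x) α σ := by
  have e : ∀ m : Matrix (Fin r) (Fin r) ℂ, ∑ i, ∑ j, vPart x i * m i j * conj (vPart x j)
      = vPart x ⬝ᵥ m *ᵥ star (vPart x) := by
    intro m
    simp [dotProduct, mulVec, Finset.mul_sum, mul_assoc]
  -- `curvRight` already carries `v̄`, so contracting its free fibre index with `v` gives a row of
  -- `-M`; `rr` is the adjoint statement, giving a column.
  have l : vPart x ᵥ* curvRight h x α = - negCurvForm h x α := by
    funext β
    simp only [vecMul, dotProduct, curvRight, Matrix.of_apply, negCurvForm, Finset.mul_sum,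
      Pi.neg_apply, neg_neg]
    exact Finset.sum_congr rfl fun i _ => Finset.sum_congr rfl fun j _ => by ring
  have rr : curvLeft h x σ *ᵥ star (vPart x) = fun γ => - negCurvForm h x γ σ := by
    funext γ
    simp only [mulVec, dotProduct, curvLeft, Matrix.of_apply, negCurvForm, Finset.sum_mul,
      Pi.star_apply, RCLike.star_def, neg_neg]
    exact Finset.sum_comm
  have c : vPart x ⬝ᵥ curvMatrix h α σ (zPart x) *ᵥ star (vPart x) = - negCurvForm h x α σ := by
    rw [← e]
    simp only [negCurvForm, Matrix.of_apply, neg_neg, curvCoeff_eq_curvMatrix]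
    exact Finset.sum_congr rfl fun i _ => Finset.sum_congr rfl fun j _ => by ring
  rw [e, hp.vertical_curvMatrix_inl hx, add_mulVec, dotProduct_add, c, ← mulVec_mulVec, rr,
    dotProduct_mulVec, ← vecMul_vecMul, l, horMetric_eq, Matrix.sub_apply, Matrix.mul_apply]
  simp only [dotProduct, vecMul, Matrix.mul_apply, Pi.neg_apply, neg_mul, Finset.sum_neg_distrib,
    mul_neg, neg_neg]
  ring

end IsNegativePair

end LocalCurvature

/-! ### From the bundle to matrices of coefficients -/

section Coefficients

open Matrix

variable {n r : ℕ} {M : Type*} [TopologicalSpace M] [ChartedSpace (Fin n → ℂ) M]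
  {E : M → Type*} [∀ x, AddCommGroup (E x)] [∀ x, Module ℂ (E x)]
  [TopologicalSpace (Bundle.TotalSpace (Fin r → ℂ) E)] [∀ x, TopologicalSpace (E x)]
  [FiberBundle (Fin r → ℂ) E]
  (g : KahlerMetric n M) (G : HermitianMetric n r E) (c : LocalCoords n r E)

theorem HermitianMetric.form_sum_sum (p : M) (e : Fin r → E p) (u w : Fin r → ℂ) :
    G.form p (∑ i, u i • e i) (∑ j, w j • e j)
      = ∑ i, ∑ j, G.form p (e i) (e j) * u i * conj (w j) := by
  simp only [map_sum, LinearMap.sum_apply, map_smul, LinearMap.smul_apply, LinearMap.map_smulₛₗ,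
    smul_eq_mul, Finset.mul_sum]
  rw [Finset.sum_comm]
  refine Finset.sum_congr rfl fun i _ => Finset.sum_congr rfl fun j _ => ?_
  ring

theorem potential_point (y : Fin n ⊕ Fin r → ℂ) :
    G.potential (c.point y) = sesqPotential (G.coeff c) y :=
  G.form_sum_sum _ _ _ _

theorem Omega_eq_totalMetric : Omega g G c = totalMetric (g.coeff c.chart) (G.coeff c) := by
  funext x
  simp only [Omega, totalMetric, leviG, potential_point]

theorem posDef_coeff {z : Fin n → ℂ} (hz : z ∈ c.chart.target) : (G.coeff c z).PosDef := by
  have hherm : (G.coeff c z).IsHermitian := by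
    ext i j
    exact (G.conj_symm _ _ _).symm
  refine PosDef.of_dotProduct_mulVec_pos hherm fun w hw => ?_
  have hli := c.isLocalFrame.linearIndependent (c.chart.map_target hz)
  -- The frame is linearly independent. The vector has coefficients `star w` because the form on `E`
  -- is conjugate linear in its second slot, the matrix form in its first.
  have hne : ∑ i, star w i • c.frame i (c.chart.symm z) ≠ 0 := by
    intro h0
    refine star_ne_zero.2 hw ?_
    funext i
    exact Fintype.linearIndependent_iff.1 hli (star w) h0 i
  have hpos := G.pos _ _ hne
  rw [G.form_sum_sum] at hpos
  have e : star w ⬝ᵥ (G.coeff c z *ᵥ w) = ∑ i, ∑ j,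
      G.form (c.chart.symm z) (c.frame i (c.chart.symm z)) (c.frame j (c.chart.symm z))
        * star w i * conj (star w j) := by
    simp only [dotProduct, mulVec, HermitianMetric.coeff, Matrix.of_apply, Finset.mul_sum,
      Pi.star_apply, RCLike.star_def, Complex.conj_conj]
    refine Finset.sum_congr rfl fun i _ => Finset.sum_congr rfl fun j _ => ?_
    ring
  rw [Complex.lt_def]
  exact ⟨by rw [e]; exact hpos, (hherm.im_star_dotProduct_mulVec_self w).symm⟩

theorem isNegativePair_coeff (hG : G.GriffithsNegative) :
    IsNegativePair (g.coeff c.chart) (G.coeff c) c.chart.target where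
  isOpen := c.chart.open_target
  kahler := g.isKahlerOn c.chart c.chart_mem
  smooth _ hz i j := (G.smooth c i j).contDiffAt (c.chart.open_target.mem_nhds hz)
  posDef _ hz := posDef_coeff G c hz
  negative z hz v hv ξ hξ := hG c z hz v hv ξ hξ

variable {g G c}

theorem hor_eq_horLift (hp : IsNegativePair (g.coeff c.chart) (G.coeff c) c.chart.target)
    {y : Fin n ⊕ Fin r → ℂ} (hy : zPart y ∈ c.chart.target) (α : Fin n) :
    hor G c α y = horLift (G.coeff c) y α := by
  -- The base metric does not meet the off-diagonal blocks, so these entries can be read from Ω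
  -- itself.
  have hl : ∀ l, leviG G c y (Sum.inl α) (Sum.inr l) = leviMixed (G.coeff c) y α l := by
    intro l
    have := congrFun (congrFun (hp.totalMetric_blocks hy) (Sum.inl α)) (Sum.inr l)
    rw [← Omega_eq_totalMetric] at this
    simpa [Omega] using this
  funext A
  rcases A with β | i
  · simp [hor, horLift, Matrix.one_apply, Pi.single_apply, eq_comm]
  · simp [hor, horLift, Pi.single_apply, hl, Matrix.mul_apply]

theorem taut_inl (x : Fin n ⊕ Fin r → ℂ) (α : Fin n) : taut x (Sum.inl α) = 0 := by
  simp [taut]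

theorem taut_inr (x : Fin n ⊕ Fin r → ℂ) (i : Fin r) : taut x (Sum.inr i) = vPart x i := by
  simp [taut, Pi.single_apply]

theorem sum_contraction {ι κ μ ν : Type*} [Fintype ι] [Fintype κ] [Fintype μ] [Fintype ν]
    (a : ι → μ → ℂ) (b : κ → ν → ℂ) (q : μ → ν → ℂ) :
    ∑ γ, (∑ β, (∑ l, a l β) * q β γ) * ∑ k, b k γ
      = ∑ k, ∑ l, ∑ β, ∑ γ, a l β * b k γ * q β γ := by
  have rev : ∀ f : ι → μ → ν → ℂ, ∑ l, ∑ β, ∑ γ, f l β γ = ∑ γ, ∑ β, ∑ l, f l β γ := by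
    intro f
    rw [Finset.sum_comm, Finset.sum_comm (f := fun γ β => ∑ l, f l β γ)]
    exact Finset.sum_congr rfl fun β _ => Finset.sum_comm
  simp only [rev]
  rw [Finset.sum_comm]
  refine Finset.sum_congr rfl fun γ _ => ?_
  rw [Finset.mul_sum]
  refine Finset.sum_congr rfl fun k _ => ?_
  rw [Finset.sum_mul]
  refine Finset.sum_congr rfl fun β _ => ?_
  rw [Finset.sum_mul, Finset.sum_mul]
  exact Finset.sum_congr rfl fun l _ => by ring

theorem horMetric_eq_OmegaH (x : Fin n ⊕ Fin r → ℂ) :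
    horMetric (g.coeff c.chart) (G.coeff c) x = OmegaH g G c x := rfl

variable (hG : G.GriffithsNegative) {x : Fin n ⊕ Fin r → ℂ} (hx : x ∈ c.domain)

include hG hx

/-- By tensoriality only the values of `s` and `t` at `x` enter; `s` must be smooth because the
operators differentiate it, while `t` may be arbitrary. -/
theorem curvOmega_eq (X Y : Fin n ⊕ Fin r → ℂ)
    {s : (Fin n ⊕ Fin r → ℂ) → (Fin n ⊕ Fin r → ℂ)}
    (hs : ∀ A, ContDiffAt ℝ ∞ (fun y => s y A) x)
    (t : (Fin n ⊕ Fin r → ℂ) → (Fin n ⊕ Fin r → ℂ)) :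
    curvOmega g G c X Y s t x = ∑ A, ∑ B, (∑ p, ∑ q, s x p *
      curvMatrix (totalMetric (g.coeff c.chart) (G.coeff c)) A B x p q * conj (t x q))
        * X A * conj (Y B) := by
  have hp := isNegativePair_coeff g G c hG
  rw [curvOmega, Omega_eq_totalMetric]
  exact herm_chernCurvature (hp.smoothAt_totalMetric hx) (hp.posDef_totalMetric hx).isUnit X Y hs _

theorem curvOmega_vert (i j : Fin r) (X Y : Fin n ⊕ Fin r → ℂ) :
    curvOmega g G c X Y (vert i) (vert j) x =
      ∑ α, ∑ σ,
        ((∑ k, ∑ l, ∑ β, ∑ γ,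
            G.R c i l α β (zPart x) * G.R c k j γ σ (zPart x)
              * vPart x k * conj (vPart x l) * (OmegaH g G c x)⁻¹ β γ)
          + G.R c i j α σ (zPart x)) * X (Sum.inl α) * conj (Y (Sum.inl σ)) := by
  have hp := isNegativePair_coeff g G c hG
  have hin : ∀ A B : Fin n ⊕ Fin r, ∑ p, ∑ q, (vert i x : Fin n ⊕ Fin r → ℂ) p *
      curvMatrix (totalMetric (g.coeff c.chart) (G.coeff c)) A B x p q
        * conj ((vert j x : Fin n ⊕ Fin r → ℂ) q)
      = (curvMatrix (totalMetric (g.coeff c.chart) (G.coeff c)) A B x).toBlocks₂₂ i j := by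
    intro A B
    simp [vert, Pi.single_apply, toBlocks₂₂]
  rw [curvOmega_eq hG hx X Y (s := vert i) (fun A => contDiffAt_const)]
  simp only [hin]
  simp only [Fintype.sum_sum_type (α₁ := Fin n), hp.vertical_curvMatrix_inr_left hx,
    hp.vertical_curvMatrix_inr_right hx, Matrix.zero_apply, zero_mul, Finset.sum_const_zero,
    add_zero]
  refine Finset.sum_congr rfl fun α _ => Finset.sum_congr rfl fun σ _ => ?_
  congr 2
  rw [hp.vertical_curvMatrix_inl hx, Matrix.add_apply, add_comm]
  refine congrArg₂ _ ?_ (curvCoeff_eq_curvMatrix _ _ _ _ _ _).symm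
  rw [← horMetric_eq_OmegaH]
  simp only [Matrix.mul_apply, curvLeft, curvRight, Matrix.of_apply]
  refine (sum_contraction _ _ _).trans ?_
  refine Finset.sum_congr rfl fun k _ => Finset.sum_congr rfl fun l _ =>
    Finset.sum_congr rfl fun β _ => Finset.sum_congr rfl fun γ _ => ?_
  simp only [HermitianMetric.R]
  ring

theorem curvOmega_hor (α β : Fin n) (X Y : Fin n ⊕ Fin r → ℂ) :
    curvOmega g G c X Y (hor G c α) (hor G c β) x =
      (∑ A, ∑ B, (∑ γ,
          -dzbar B (fun y => ∑ σ,
              dz A (fun y' => OmegaH g G c y' α σ) y * (OmegaH g G c y)⁻¹ σ γ) x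
            * OmegaH g G c x γ β) * X A * conj (Y B))
      - ∑ γ, ∑ σ,
          (∑ p, ∑ q, ∑ k, ∑ l,
            G.R c p l γ β (zPart x) * G.R c k q α σ (zPart x)
              * vPart x k * conj (vPart x l) * (G.coeff c (zPart x))⁻¹ q p)
            * X (Sum.inl γ) * conj (Y (Sum.inl σ)) := by
  have hp := isNegativePair_coeff g G c hG
  -- The field agrees with `horLift` only over the chart, so smoothness is transferred through
  -- equality near `x`.
  have hs : ∀ A, ContDiffAt ℝ ∞ (fun y => hor G c α y A) x := fun A =>
    (hp.smoothAt_horLift hx α A).congr_of_eventuallyEq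
      ((hp.eventually_mem hx).mono fun y hy => by simp only [hor_eq_horLift hp hy])
  have hin : ∀ A B : Fin n ⊕ Fin r, ∑ p, ∑ q, hor G c α x p *
      curvMatrix (totalMetric (g.coeff c.chart) (G.coeff c)) A B x p q
        * conj (hor G c β x q)
      = (horLift (G.coeff c) x * curvMatrix (totalMetric (g.coeff c.chart) (G.coeff c)) A B x
          * horLift' (G.coeff c) x) α β := by
    intro A B
    rw [← hp.conjTranspose_horLift hx, hor_eq_horLift hp hx, hor_eq_horLift hp hx]
    simp only [Matrix.mul_apply, conjTranspose_apply, Finset.sum_mul, RCLike.star_def]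
    exact Finset.sum_comm
  -- The curvature of the quotient metric is rewritten as ∂̄ of its own connection matrix; the sign
  -- comes from moving `dx̄^B` past `dx^A`.
  have hQ : ∀ A B : Fin n ⊕ Fin r, ∑ γ,
          -dzbar B (fun y => ∑ σ,
              dz A (fun y' => OmegaH g G c y' α σ) y * (OmegaH g G c y)⁻¹ σ γ) x
            * OmegaH g G c x γ β
      = curvMatrix (horMetric (g.coeff c.chart) (G.coeff c)) A B x α β := by
    intro A B
    have := congrFun (congrFun (matWirtinger_connection_mul (A := A) (B := B)
      (hp.smoothAt_horMetric hx) (hp.posDef_horMetric hx).isUnit) α) β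
    rw [Matrix.neg_apply, Matrix.mul_apply] at this
    rw [← neg_eq_iff_eq_neg.2 this.symm.symm]
    simp only [neg_mul, Finset.sum_neg_distrib, dz_eq_wirtinger, dzbar_eq_wirtinger]
    rfl
  rw [curvOmega_eq hG hx X Y hs]
  simp only [hin, hQ]
  simp only [Fintype.sum_sum_type (α₁ := Fin n), hp.horizontal_curvMatrix_inr_left hx,
    hp.horizontal_curvMatrix_inr_right hx, hp.horizontal_curvMatrix_inl hx, Matrix.sub_apply,
    sub_mul, Finset.sum_sub_distrib]
  have e : ∀ γ σ, (curvLeft (G.coeff c) x σ * (G.coeff c (zPart x))⁻¹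
      * curvRight (G.coeff c) x γ) α β = ∑ p, ∑ q, ∑ k, ∑ l,
            G.R c p l γ β (zPart x) * G.R c k q α σ (zPart x)
              * vPart x k * conj (vPart x l) * (G.coeff c (zPart x))⁻¹ q p := by
    intro γ σ
    simp only [Matrix.mul_apply, curvLeft, curvRight, Matrix.of_apply]
    refine Finset.sum_congr rfl fun p _ => ?_
    rw [Finset.sum_mul]
    refine Finset.sum_congr rfl fun q _ => ?_
    rw [Finset.sum_mul, Finset.sum_mul]
    refine Finset.sum_congr rfl fun k _ => ?_
    rw [Finset.mul_sum]
    refine Finset.sum_congr rfl fun l _ => ?_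
    simp only [HermitianMetric.R]
    ring
  simp only [e, Finset.sum_add_distrib, Finset.sum_sub_distrib]
  ring

/-- `P` is vertical, so only the base part of `X` survives. The double `star` puts the value in the
form `star w ⬝ᵥ (N *ᵥ w)` with `w = star (zPart X)`, to which definiteness applies. -/
theorem curvOmega_taut (X : Fin n ⊕ Fin r → ℂ) :
    curvOmega g G c X X taut taut x = -(star (star (zPart X)) ⬝ᵥ
      ((negCurvForm (G.coeff c) x - negCurvForm (G.coeff c) x
        * (negCurvForm (G.coeff c) x + g.coeff c.chart (zPart x))⁻¹
        * negCurvForm (G.coeff c) x) *ᵥ star (zPart X))) := by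
  have hp := isNegativePair_coeff g G c hG
  have hs : ∀ A, ContDiffAt ℝ ∞ (fun y : Fin n ⊕ Fin r → ℂ => taut y A) x := by
    rintro (α | i)
    · simp only [taut_inl]
      exact contDiffAt_const
    · simp only [taut_inr]
      exact (contDiff_vPart i).contDiffAt
  have hin : ∀ A B : Fin n ⊕ Fin r, ∑ p, ∑ q, taut x p *
      curvMatrix (totalMetric (g.coeff c.chart) (G.coeff c)) A B x p q * conj (taut x q)
      = ∑ i, ∑ j, vPart x i *
        (curvMatrix (totalMetric (g.coeff c.chart) (G.coeff c)) A B x).toBlocks₂₂ i j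
          * conj (vPart x j) := by
    intro A B
    simp [Fintype.sum_sum_type, taut_inl, taut_inr, toBlocks₂₂]
  rw [curvOmega_eq hG hx X X hs]
  simp only [hin]
  simp only [Fintype.sum_sum_type (α₁ := Fin n), hp.vertical_curvMatrix_inr_left hx,
    hp.vertical_curvMatrix_inr_right hx, Matrix.zero_apply, zero_mul, mul_zero,
    Finset.sum_const_zero, add_zero, hp.taut_curvMatrix hx]
  simp only [dotProduct, mulVec, Finset.mul_sum, neg_mul, Finset.sum_neg_distrib,
    Pi.star_apply, RCLike.star_def, Complex.conj_conj, zPart]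
  refine congrArg _ (Finset.sum_congr rfl fun α _ => Finset.sum_congr rfl fun σ _ => ?_)
  ring

theorem zPart_sum_hor (ξ : Fin n → ℂ) : zPart (∑ α, ξ α • hor G c α x) = ξ := by
  funext β
  simp [zPart, hor, Pi.single_apply]

end Coefficients

end TotalSpaceCurvature

end

/-! ### The theorem in a given coordinate system and frame -/

theorem mainTheorem4 {n r : ℕ}
    {M : Type*} [TopologicalSpace M] [ChartedSpace (Fin n → ℂ) M]
    [IsManifold 𝓘(ℂ, Fin n → ℂ) ω M]
    {E : M → Type*} [∀ x, AddCommGroup (E x)] [∀ x, Module ℂ (E x)]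
    [TopologicalSpace (Bundle.TotalSpace (Fin r → ℂ) E)] [∀ x, TopologicalSpace (E x)]
    [FiberBundle (Fin r → ℂ) E] [VectorBundle ℂ (Fin r → ℂ) E]
    [ContMDiffVectorBundle ω (Fin r → ℂ) E 𝓘(ℂ, Fin n → ℂ)]
    (g : KahlerMetric n M) (G : HermitianMetric n r E) (hG : G.GriffithsNegative)
    (c : LocalCoords n r E) :
    -- `Ω` is a Kähler metric, so that its Chern connection is defined
    IsKahlerOn (Omega g G c) c.domain ∧
    ∀ x ∈ c.domain,
      -- `⟨R^Ω(∂/∂v^i), ∂/∂v^j⟩` as a `(1,1)`-form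
      (∀ (i j : Fin r) (X Y : Fin n ⊕ Fin r → ℂ),
        curvOmega g G c X Y (vert i) (vert j) x =
          ∑ α, ∑ σ,
            ((∑ k, ∑ l, ∑ β, ∑ γ,
                G.R c i l α β (zPart x) * G.R c k j γ σ (zPart x)
                  * vPart x k * conj (vPart x l) * (OmegaH g G c x)⁻¹ β γ)
              + G.R c i j α σ (zPart x)) * X (Sum.inl α) * conj (Y (Sum.inl σ))) ∧
      -- `⟨R^Ω(δ/δz^α), δ/δz^β⟩` as a `(1,1)`-form; `∂̄(f_A dx^A) = -∂_B̄ f_A dx^A ∧ dx̄^B`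
      (∀ (α β : Fin n) (X Y : Fin n ⊕ Fin r → ℂ),
        curvOmega g G c X Y (hor G c α) (hor G c β) x =
          (∑ A, ∑ B, (∑ γ,
              -dzbar B (fun y => ∑ σ,
                  dz A (fun y' => OmegaH g G c y' α σ) y * (OmegaH g G c y)⁻¹ σ γ) x
                * OmegaH g G c x γ β) * X A * conj (Y B))
          - ∑ γ, ∑ σ,
              (∑ p, ∑ q, ∑ k, ∑ l,
                G.R c p l γ β (zPart x) * G.R c k q α σ (zPart x)
                  * vPart x k * conj (vPart x l) * (G.coeff c (zPart x))⁻¹ q p)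
                * X (Sum.inl γ) * conj (Y (Sum.inl σ))) ∧
      -- on vertical vectors `⟨R^Ω(∂/∂v^i), ∂/∂v^j⟩` vanishes
      (∀ (i j : Fin r) (X Y : Fin n ⊕ Fin r → ℂ), (zPart X = 0 ∨ zPart Y = 0) →
        curvOmega g G c X Y (vert i) (vert j) x = 0) ∧
      -- `⟨iR^Ω(P), P⟩` is a real non-positive `(1,1)`-form
      (∀ X : Fin n ⊕ Fin r → ℂ,
        (curvOmega g G c X X taut taut x).im = 0 ∧ (curvOmega g G c X X taut taut x).re ≤ 0) ∧
      -- and it is strictly negative along horizontal directions off the zero section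
      (vPart x ≠ 0 → ∀ ξ : Fin n → ℂ, ξ ≠ 0 →
        (curvOmega g G c (∑ α, ξ α • hor G c α x) (∑ α, ξ α • hor G c α x) taut taut x).re < 0) := by
  have hp := isNegativePair_coeff g G c hG
  refine ⟨?_, fun x hx => ⟨curvOmega_vert hG hx, curvOmega_hor hG hx, ?_, ?_, ?_⟩⟩
  · rw [Omega_eq_totalMetric]
    exact hp.isKahlerOn_totalMetric
  -- Formula (i) involves only the base components of `X` and `Y`, so (iii) follows from it.
  · intro i j X Y hXY
    rw [curvOmega_vert hG hx]
    refine Finset.sum_eq_zero fun α _ => Finset.sum_eq_zero fun σ _ => ?_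
    rcases hXY with h | h
    · have : X (Sum.inl α) = 0 := congrFun h α
      rw [this, mul_zero, zero_mul]
    · have : Y (Sum.inl σ) = 0 := congrFun h σ
      rw [this, map_zero, mul_zero]
  · intro X
    have h0 := (posSemidef_sub_mul_inv_mul (hp.posSemidef_negCurvForm hx)
      (hp.kahler.posDef _ hx)).dotProduct_mulVec_nonneg (star (zPart X))
    rw [curvOmega_taut hG hx, Complex.neg_im, Complex.neg_re]
    rw [Complex.le_def] at h0
    exact ⟨neg_eq_zero.2 h0.2.symm, neg_nonpos.2 h0.1⟩
  -- Off the zero section `M` is definite, and a horizontal vector has base part ξ, which is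
  -- nonzero.
  · intro hv ξ hξ
    have h0 := (posDef_sub_mul_inv_mul (hp.posDef_negCurvForm hx hv)
      (hp.kahler.posDef _ hx)).dotProduct_mulVec_pos (star_ne_zero.2 hξ)
    rw [curvOmega_taut hG hx, Complex.neg_re, zPart_sum_hor hG hx]
    rw [Complex.lt_def] at h0
    exact neg_neg_iff_pos.2 h0.1
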